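/- Let $n,k,l\ge 1$ be integers and let $A_{k,l}=(-\Delta)^l+|x|^{2k}+1$ be the anharmonic oscillator on $\mathbb{R}^n$. Let $(u_j)_{j\in\mathbb{N}}$ be any orthonormal basis of the complex Hilbert space $L^2(\mathbb{R}^n)$ consisting of eigenfunctions of $A_{k,l}$, i.e. $0\ne u_j\in L^2(\mathbb{R}^n)$ and $A_{k,l}u_j=\lambda_j u_j$ in the sense of tempered distributions, for some numbers $\lambda_j$. For a function $f$ put $$\mathcal{F}_{A_{k,l}}f(j)=\int_{\mathbb{R}^n}f(x)\,\overline{u_j(x)}\,dx,\qquad j\in\mathbb{N}.$$ Let $1\le p\le 2$, $\frac1p+\frac1{p'}=1$, and let $f\in L^p(\mathbb{R}^n)$. Then $\|u_j\|_{L^\infty(\mathbb{R}^n)}<\infty$ and $f\,\overline{u_j}$ is integrable for every $j$ (so that all the quantities below are well defined), and $$\Big(\sum_{j\in\mathbb{N}}|\mathcal{F}_{A_{k,l}}f(j)|^{p'}\,\|u_j\|_{L^\infty(\mathbb{R}^n)}^{2-p'}\Big)^{1/p'}\le\|f\|_{L^p(\mathbb{R}^n)},$$ where for $p=1$, $p'=\infty$,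 the left-hand side is understood as $\sup_{j\in\mathbb{N}}|\mathcal{F}_{A_{k,l}}f(j)|\,\|u_j\|_{L^\infty(\mathbb{R}^n)}^{-1}$. -/

import Mathlib

open MeasureTheory
open scoped ENNReal SchwartzMap Laplacian ComplexConjugate

namespace Anharmonic

/-- The space `ℝⁿ` with its Euclidean norm. -/
abbrev Space (n : ℕ) : Type := EuclideanSpace ℝ (Fin n)

/-- The complex Hilbert space `L²(ℝⁿ)`. -/
abbrev L2 (n : ℕ) : Type := Lp ℂ 2 (volume : Measure (Space n))

/-- The potential `x ↦ |x|^{2k}` on `ℝⁿ`. -/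
noncomputable def potential (n k : ℕ) : Space n → ℂ := fun x ↦ ((‖x‖ ^ (2 * k) : ℝ) : ℂ)

/-- The potential has temperate growth, so `TemperedDistribution.smulLeftCLM` really is the
multiplication by it. -/
theorem potential_hasTemperateGrowth (n k : ℕ) :
    Function.HasTemperateGrowth (potential n k) := by
  have h : Function.HasTemperateGrowth (fun x : Space n ↦ (‖x‖ ^ 2) ^ k) := by
    fun_prop
  have h' : Function.HasTemperateGrowth (fun x : Space n ↦ (((‖x‖ ^ 2) ^ k : ℝ) : ℂ)) := by
    fun_prop
  have e : potential n k = fun x : Space n ↦ (((‖x‖ ^ 2) ^ k : ℝ) : ℂ) := by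
    funext x
    simp only [potential, pow_mul]
  rw [e]
  exact h'

/-- The anharmonic oscillator `A_{k,l} = (-Δ)^l + |x|^{2k} + 1`, acting on tempered
distributions on `ℝⁿ`. -/
noncomputable def oscillator (n k l : ℕ) (v : 𝓢'(Space n, ℂ)) : 𝓢'(Space n, ℂ) :=
  (fun w : 𝓢'(Space n, ℂ) ↦ -Δ w)^[l] v
    + TemperedDistribution.smulLeftCLM ℂ (potential n k) v + v

/-- `v` is an eigenfunction in `L²(ℝⁿ)` of the anharmonic oscillator `A_{k,l}` for the
eigenvalue `μ`: it is non-zero and `A_{k,l} v = μ v`, where the operator acts in the sense of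
distributions (its domain in `L²` consists of the `v` for which `A_{k,l} v` is again in `L²`). -/
def IsEigenfunction {n : ℕ} (k l : ℕ) (v : L2 n) (μ : ℂ) : Prop :=
  v ≠ 0 ∧ oscillator n k l (v : 𝓢'(Space n, ℂ)) = μ • (v : 𝓢'(Space n, ℂ))

/-- The Fourier transform `f ↦ (j ↦ ∫ f(x) conj(u_j(x)) dx)` associated with a sequence `u`. -/
noncomputable def fourierCoeff {n : ℕ} (u : ℕ → L2 n) (f : Space n → ℂ) (j : ℕ) : ℂ :=
  ∫ x, f x * conj (u j x)

/-- The norm `‖u_j‖_{L^∞}`, with values in `[0, ∞]`. -/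
noncomputable def supNorm {n : ℕ} (v : L2 n) : ℝ≥0∞ := eLpNorm v ∞ volume

/-- The norm of the weighted sequence space `ℓ^q` of Fourier coefficients:
`(∑_j |a_j|^q ‖u_j‖_∞^{2-q})^{1/q}` for finite `q`, and `sup_j |a_j| ‖u_j‖_∞^{-1}` for
`q = ∞`. -/
noncomputable def ellNorm {n : ℕ} (u : ℕ → L2 n) (q : ℝ≥0∞) (a : ℕ → ℂ) : ℝ≥0∞ :=
  if q = ∞ then ⨆ j, ‖a j‖ₑ * (supNorm (u j))⁻¹
  else (∑' j, ‖a j‖ₑ ^ q.toReal * supNorm (u j) ^ (2 - q.toReal)) ^ (1 / q.toReal)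

end Anharmonic

/-! The inequality interpolates between two endpoints. Write a_j for the coefficients and M_j =
‖u_j‖_∞. The sum equals ∑ |a_j / M_j|^{p'} M_j², so it is an ℓ^{p'} norm of a_j / M_j for the
measure giving mass M_j² to j. For p = 1 the bound is |∫ f conj(u_j)| ≤ M_j ‖f‖_1; for p = 2 it is
Bessel's inequality. Both have constant 1, and the three lines theorem gives the cases between
(`sum_rpow_coeff_le_simpleFunc`, extended by density in `sum_rpow_coeff_le`).

The weights make sense only if 0 < M_j < ∞, and the real work is the boundedness of an L²
eigenfunction u. Let K be the kernel of exp(-(-Δ)^l), freeze the potential at y as V = |y|^{2k}, and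
test the equation against e^{-s^{2l} V} s^{-n} K((x - y)/s), the heat kernel of (-Δ)^l + V at time
s^{2l}. Its s-derivative, paired with u, leaves only the error V + c - |x|^{2k}, where c = μ - 1.
One factor |x - y| gained from the difference of potentials, together with the weight e^{-s^{2l} V},
makes this error kernel at most a constant times a bump of width s, uniformly in y
(`exists_error_kernel_bound`). Integrating from s = ε to 1 and letting ε → 0 gives, almost
everywhere, |u(y)| ≤ C + C ∫_0^1 (average of |u| at scale s around y) ds
(`IsWeakSolution.exists_ae_bound`).

That inequality bootstraps. Membership in L² bounds averages at scale t by a multiple of t^{-n};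
each application lowers the exponent by 1/2 (`average_bootstrap`), and after 2n rounds the averages,
hence u, are bounded. -/

namespace Anharmonic

open Filter Topology Real

/-! ### The heat kernel of (-Δ)^l as a Schwartz function -/

/-- A smooth function on the line which is `exp (-s)` for `s ≥ 0` and vanishes for `s ≤ -1`. -/
noncomputable def cutoffExp (s : ℝ) : ℂ := ((Real.smoothTransition (s + 1) * Real.exp (-s) : ℝ) : ℂ)

/-- The symbol of (-Δ)^l takes only nonnegative values, so the change made on the negative axis,
whose purpose is a Schwartz function on the whole line, disappears after composition. -/
theorem cutoffExp_of_nonneg {s : ℝ} (hs : 0 ≤ s) : cutoffExp s = (Real.exp (-s) : ℝ) := by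
  rw [cutoffExp, Real.smoothTransition.one_of_one_le (by linarith), one_mul]

theorem cutoffExp_of_le {s : ℝ} (hs : s ≤ -1) : cutoffExp s = 0 := by
  rw [cutoffExp, Real.smoothTransition.zero_of_nonpos (by linarith), zero_mul, Complex.ofReal_zero]

theorem contDiff_cutoffExp {m : ℕ∞} : ContDiff ℝ m cutoffExp := by
  have h : ContDiff ℝ m fun s : ℝ ↦ Real.smoothTransition (s + 1) * Real.exp (-s) :=
    (Real.smoothTransition.contDiff.comp (contDiff_id.add contDiff_const)).mul
      (Real.contDiff_exp.comp contDiff_neg)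
  exact Complex.ofRealCLM.contDiff.comp h

theorem iteratedDeriv_ofReal_exp_neg (m : ℕ) :
    iteratedDeriv m (fun s : ℝ ↦ ((Real.exp (-s) : ℝ) : ℂ))
      = fun s ↦ (-1) ^ m * ((Real.exp (-s) : ℝ) : ℂ) := by
  induction m with
  | zero => simp
  | succ m ih =>
    rw [iteratedDeriv_succ, ih]
    funext s
    have h : HasDerivAt (fun s : ℝ ↦ ((Real.exp (-s) : ℝ) : ℂ)) ((Real.exp (-s) * -1 : ℝ) : ℂ) s :=
      ((hasDerivAt_neg s).exp).ofReal_comp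
    rw [(h.const_mul _).deriv]
    push_cast
    ring

/-- The line splits at -1 and 0: the function vanishes on the left, compactness handles the middle,
and s^k ≤ k! e^s handles the right. -/
theorem cutoffExp_decay (k m : ℕ) :
    ∃ C : ℝ, ∀ s, ‖s‖ ^ k * ‖iteratedFDeriv ℝ m cutoffExp s‖ ≤ C := by
  have hc : Continuous fun s : ℝ ↦ ‖s‖ ^ k * ‖iteratedFDeriv ℝ m cutoffExp s‖ :=
    (continuous_norm.pow k).mul
      ((contDiff_cutoffExp (m := m)).continuous_iteratedFDeriv le_rfl).norm
  obtain ⟨C, hC⟩ := (isCompact_Icc (a := (-1 : ℝ)) (b := 0)).bddAbove_image hc.continuousOn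
  refine ⟨max C k.factorial, fun s ↦ ?_⟩
  rcases lt_or_ge s (-1) with h1 | h1
  · have h : cutoffExp =ᶠ[𝓝 s] fun _ ↦ 0 := by
      filter_upwards [Iio_mem_nhds h1] with t ht using cutoffExp_of_le (le_of_lt ht)
    rw [norm_iteratedFDeriv_eq_norm_iteratedDeriv, h.iteratedDeriv_eq]
    have : (0 : ℝ) ≤ k.factorial := by positivity
    simp
  rcases le_or_gt s 0 with h0 | h0
  · exact le_max_of_le_left (hC ⟨s, ⟨h1, h0⟩, rfl⟩)
  · have h : cutoffExp =ᶠ[𝓝 s] fun s ↦ ((Real.exp (-s) : ℝ) : ℂ) := by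
      filter_upwards [Ioi_mem_nhds h0] with t ht using cutoffExp_of_nonneg (le_of_lt ht)
    rw [norm_iteratedFDeriv_eq_norm_iteratedDeriv, h.iteratedDeriv_eq,
      iteratedDeriv_ofReal_exp_neg]
    refine le_max_of_le_right ?_
    have := Real.pow_div_factorial_le_exp s h0.le k
    rw [div_le_iff₀ (by positivity)] at this
    simp only [norm_mul, norm_pow, norm_neg, norm_one, one_pow, one_mul, Complex.norm_real,
      Real.norm_eq_abs, abs_of_pos h0, Real.exp_neg, abs_of_pos (inv_pos.2 (Real.exp_pos s))]
    rw [← div_eq_mul_inv, div_le_iff₀ (Real.exp_pos s)]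
    linarith

/-- `cutoffExp` as a Schwartz function. -/
noncomputable def cutoffExpSchwartz : 𝓢(ℝ, ℂ) where
  toFun := cutoffExp
  smooth' := contDiff_cutoffExp
  decay' := cutoffExp_decay

/-- The Fourier symbol `(2π|ξ|)^{2l}` of `(-Δ)^l`. -/
noncomputable def symb (n l : ℕ) (ξ : Space n) : ℝ := ((2 * π) ^ 2 * ‖ξ‖ ^ 2) ^ l

theorem symb_nonneg (n l : ℕ) (ξ : Space n) : 0 ≤ symb n l ξ := by
  unfold symb; positivity

theorem symb_smul (n l : ℕ) (s : ℝ) (ξ : Space n) : symb n l (s • ξ) = s ^ (2 * l) * symb n l ξ := by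
  simp only [symb, norm_smul, mul_pow, Real.norm_eq_abs, sq_abs, pow_mul]
  ring

theorem symb_hasTemperateGrowth (n l : ℕ) : (symb n l).HasTemperateGrowth := by
  unfold symb
  fun_prop

/-- Growth of the symbol at infinity is what keeps a Schwartz function of the symbol Schwartz; this
is where l ≥ 1 enters. -/
theorem norm_le_one_add_symb {n l : ℕ} (hl : 1 ≤ l) (ξ : Space n) : ‖ξ‖ ≤ 1 + symb n l ξ := by
  rcases le_or_gt ‖ξ‖ 1 with h | h
  · linarith [symb_nonneg n l ξ]
  · have h1 : ‖ξ‖ ≤ (2 * π) ^ 2 * ‖ξ‖ ^ 2 := by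
      have : 1 ≤ 2 * π := by linarith [Real.pi_gt_three]
      have : 1 ≤ (2 * π) ^ 2 := one_le_pow₀ this
      nlinarith
    have h2 : (2 * π) ^ 2 * ‖ξ‖ ^ 2 ≤ symb n l ξ := le_self_pow₀ (by linarith) (by omega)
    linarith

/-- The Schwartz function `ξ ↦ exp (-(2π|ξ|)^{2l})`. -/
noncomputable def expSymb (n l : ℕ) (hl : 1 ≤ l) : 𝓢(Space n, ℂ) :=
  SchwartzMap.compCLM ℂ (symb_hasTemperateGrowth n l)
    ⟨1, 1, fun ξ ↦ by
      simpa [abs_of_nonneg (symb_nonneg n l ξ)] using norm_le_one_add_symb hl ξ⟩ cutoffExpSchwartz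

theorem expSymb_apply {n l : ℕ} (hl : 1 ≤ l) (ξ : Space n) :
    expSymb n l hl ξ = (Real.exp (-symb n l ξ) : ℝ) :=
  cutoffExp_of_nonneg (symb_nonneg n l ξ)

/-- The kernel at time one of the semigroup generated by `-(-Δ)^l`. -/
noncomputable def kernel (n l : ℕ) (hl : 1 ≤ l) : 𝓢(Space n, ℂ) :=
  FourierTransformInv.fourierInv (expSymb n l hl)

/-- `(-Δ)^l` on Schwartz functions. -/
noncomputable def negLap {n : ℕ} (l : ℕ) : 𝓢(Space n, ℂ) → 𝓢(Space n, ℂ) :=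
  (fun w ↦ -Δ w)^[l]

theorem negLap_fourierInv {n : ℕ} (l : ℕ) (h : 𝓢(Space n, ℂ)) :
    negLap l (FourierTransformInv.fourierInv h)
      = FourierTransformInv.fourierInv (SchwartzMap.smulLeftCLM ℂ (symb n l) h) := by
  induction l with
  | zero =>
    have h : symb n 0 = fun _ ↦ 1 := by funext ξ; simp [symb]
    simp [negLap, h]
  | succ l ih =>
    rw [negLap, Function.iterate_succ_apply', ← negLap, ih,
      SchwartzMap.laplacian_eq_fourierMultiplierCLM, SchwartzMap.fourierMultiplierCLM_apply,
      FourierTransform.fourier_fourierInv_eq, SchwartzMap.smulLeftCLM_smulLeftCLM_apply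
        (by fun_prop) (symb_hasTemperateGrowth n l), ← neg_smul, neg_neg,
        ← FourierTransform.fourierInv_smul]
    congr 1
    ext ξ
    have h1 := symb_hasTemperateGrowth n l
    have h2 : ((fun x : Space n ↦ ‖x‖ ^ 2) * symb n l).HasTemperateGrowth := by
      exact Function.HasTemperateGrowth.mul (by fun_prop) h1
    simp only [smul_apply]
    erw [SchwartzMap.smulLeftCLM_apply_apply h2]
    rw [SchwartzMap.smulLeftCLM_apply_apply (symb_hasTemperateGrowth n (l + 1))]
    rw [smul_smul]
    simp only [Pi.mul_apply, symb]
    congr 1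
    ring

/-- The integral is the Fourier transform at 0, where the symbol vanishes because l ≥ 1. Hence the
dilates form an approximate identity. -/
theorem integral_kernel {n l : ℕ} (hl : 1 ≤ l) : ∫ x, kernel n l hl x = 1 := by
  have hl0 : l ≠ 0 := by omega
  have h : FourierTransform.fourier (kernel n l hl) = expSymb n l hl :=
    FourierTransform.fourier_fourierInv_eq _
  have h0 := DFunLike.congr_fun h 0
  rw [SchwartzMap.fourier_coe, Real.fourier_eq', expSymb_apply] at h0
  simpa [symb, hl0] using h0

/-! ### Dilations and the heat equation in the width variable -/

/-- Precomposition of a Schwartz function with `x ↦ c (x - y)`. -/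
noncomputable def rescale {n : ℕ} (c : ℝ) (hc : c ≠ 0) (y : Space n) (f : 𝓢(Space n, ℂ)) :
    𝓢(Space n, ℂ) :=
  SchwartzMap.compSubConstCLM ℂ y (SchwartzMap.compCLMOfContinuousLinearEquiv ℂ
    (ContinuousLinearEquiv.smulLeft (Units.mk0 c hc)) f)

theorem rescale_apply {n : ℕ} (c : ℝ) (hc : c ≠ 0) (y : Space n) (f : 𝓢(Space n, ℂ))
    (x : Space n) : rescale c hc y f x = f (c • (x - y)) := rfl

theorem lineDerivOp_rescale {n : ℕ} (c : ℝ) (hc : c ≠ 0) (y m : Space n) (f : 𝓢(Space n, ℂ)) :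
    LineDeriv.lineDerivOp m (rescale c hc y f)
      = (c : ℂ) • rescale c hc y (LineDeriv.lineDerivOp m f) := by
  ext x
  rw [smul_apply, rescale_apply, SchwartzMap.lineDerivOp_apply_eq_fderiv,
    SchwartzMap.lineDerivOp_apply_eq_fderiv]
  have h : HasFDerivAt (fun x : Space n ↦ c • (x - y)) (c • ContinuousLinearMap.id ℝ (Space n)) x :=
    ((hasFDerivAt_id x).sub_const y).const_smul c
  have h' := (f.hasFDerivAt (c • (x - y))).comp x h
  have h'' : HasFDerivAt (rescale c hc y f) _ x := h'
  rw [h''.fderiv]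
  simp

theorem laplacian_rescale {n : ℕ} (c : ℝ) (hc : c ≠ 0) (y : Space n) (f : 𝓢(Space n, ℂ)) :
    Δ (rescale c hc y f) = ((c : ℂ) ^ 2) • rescale c hc y (Δ f) := by
  rw [SchwartzMap.laplacian_eq_sum (stdOrthonormalBasis ℝ (Space n)),
    SchwartzMap.laplacian_eq_sum (stdOrthonormalBasis ℝ (Space n))]
  simp only [lineDerivOp_rescale, LineDeriv.lineDerivOp_smul]
  ext x
  simp only [sum_apply, smul_apply, rescale_apply, Finset.smul_sum,
    smul_smul, sq]

theorem negLap_rescale {n : ℕ} (l : ℕ) (c : ℝ) (hc : c ≠ 0) (y : Space n) (f : 𝓢(Space n, ℂ)) :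
    negLap l (rescale c hc y f) = ((c : ℂ) ^ (2 * l)) • rescale c hc y (negLap l f) := by
  induction l with
  | zero => simp [negLap]
  | succ l ih =>
    have h : ∀ w : 𝓢(Space n, ℂ), negLap (l + 1) w = -Δ (negLap l w) := fun w ↦ by
      rw [negLap, Function.iterate_succ_apply', ← negLap]
    have hs : ∀ (a : ℂ) (w : 𝓢(Space n, ℂ)), Δ (a • w) = a • Δ w := fun a w ↦ by
      rw [← SchwartzMap.laplacianCLM_eq (𝕜 := ℂ), map_smul, SchwartzMap.laplacianCLM_eq]
    rw [h, h, ih, hs, laplacian_rescale]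
    ext x
    simp only [smul_apply, neg_apply, rescale_apply, smul_eq_mul]
    ring

/-- Moves the dilation onto the symbol, so that s can be differentiated under the integral sign. -/
theorem fourierInv_dilation {n : ℕ} (h : 𝓢(Space n, ℂ)) {s : ℝ} (hs : 0 < s) (z : Space n) :
    ((s ^ n)⁻¹ : ℝ) * FourierTransformInv.fourierInv h (s⁻¹ • z)
      = ∫ v : Space n, Complex.exp (((2 * π * inner ℝ v z : ℝ) : ℂ) * Complex.I) * h (s • v) := by
  rw [SchwartzMap.fourierInv_coe, Real.fourierInv_eq']
  have := Measure.integral_comp_smul (volume : Measure (Space n))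
    (fun v : Space n ↦ Complex.exp (((2 * π * inner ℝ v (s⁻¹ • z) : ℝ) : ℂ) * Complex.I) • h v) s
  rw [finrank_euclideanSpace_fin, abs_of_pos (by positivity)] at this
  rw [← Complex.real_smul, ← this]
  refine integral_congr_ae (ae_of_all _ fun v ↦ ?_)
  simp only [inner_smul_left, inner_smul_right, smul_eq_mul]
  rw [conj_trivial, inv_mul_cancel_left₀ hs.ne']

/-- This is the heat equation with time s^{2l}: on the Fourier side the dilated kernel is
exp(-s^{2l} σ), with σ the symbol, and its s-derivative brings down -2l s^{2l-1} σ. -/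
theorem hasDerivAt_dilation_kernel {n l : ℕ} (hl : 1 ≤ l) {s : ℝ} (hs : 0 < s) (z : Space n) :
    HasDerivAt (fun s : ℝ ↦ ((s ^ n)⁻¹ : ℝ) * kernel n l hl (s⁻¹ • z))
      (-(2 * l * s⁻¹ : ℝ) * (((s ^ n)⁻¹ : ℝ) * negLap l (kernel n l hl) (s⁻¹ • z))) s := by
  have hneg : negLap l (kernel n l hl) = FourierTransformInv.fourierInv
      (SchwartzMap.smulLeftCLM ℂ (symb n l) (expSymb n l hl)) := negLap_fourierInv l _
  rw [hneg, fourierInv_dilation _ hs]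
  set e : Space n → ℂ := fun v ↦ Complex.exp (((2 * π * inner ℝ v z : ℝ) : ℂ) * Complex.I) with he
  have hec : Continuous e := by fun_prop
  have hsm : ∀ v, SchwartzMap.smulLeftCLM ℂ (symb n l) (expSymb n l hl) v
      = ((symb n l v * Real.exp (-symb n l v) : ℝ) : ℂ) := fun v ↦ by
    rw [SchwartzMap.smulLeftCLM_apply_apply (symb_hasTemperateGrowth n l), expSymb_apply]
    simp
  have hint : ∀ (f : 𝓢(Space n, ℂ)) {c : ℝ}, c ≠ 0 → Integrable fun v ↦ f (c • v) :=
    fun f c hc ↦ f.integrable.comp_smul hc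
  have key := hasDerivAt_integral_of_dominated_loc_of_deriv_le (μ := (volume : Measure (Space n)))
    (F := fun (t : ℝ) v ↦ e v * expSymb n l hl (t • v))
    (F' := fun (t : ℝ) v ↦ e v * ((-(2 * l * t ^ (2 * l - 1) * symb n l v)
      * Real.exp (-symb n l (t • v)) : ℝ) : ℂ))
    -- For t in (s/2, 2s) the power of t is largest at 2s and the exponential at s/2. The factor
    -- ((s/2)^{2l})⁻¹ corrects for evaluating the Schwartz function σ e^{-σ} at (s/2)v.
    (bound := fun v ↦ (2 * l * (2 * s) ^ (2 * l - 1)) * ((s / 2) ^ (2 * l))⁻¹ *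
      ‖SchwartzMap.smulLeftCLM ℂ (symb n l) (expSymb n l hl) ((s / 2) • v)‖)
    (x₀ := s) (s := Set.Ioo (s / 2) (2 * s)) (Ioo_mem_nhds (by linarith) (by linarith))
    ?_ ?_ ?_ ?_ ?_ ?_
  · have h2 := key.2
    have hF : (fun s : ℝ ↦ ((s ^ n)⁻¹ : ℝ) * kernel n l hl (s⁻¹ • z)) =ᶠ[𝓝 s]
        fun t ↦ ∫ v, e v * expSymb n l hl (t • v) := by
      filter_upwards [Ioi_mem_nhds hs] with t ht using fourierInv_dilation _ ht z
    refine (h2.congr_of_eventuallyEq hF).congr_deriv ?_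
    rw [← integral_const_mul]
    refine integral_congr_ae (ae_of_all _ fun v ↦ ?_)
    simp only [hsm, symb_smul]
    have : s ^ (2 * l) = s ^ (2 * l - 1) * s := by rw [← pow_succ]; congr 1; omega
    have hs' : (s : ℂ) ≠ 0 := by exact_mod_cast hs.ne'
    rw [this]
    push_cast
    field_simp
    simp only [he]
    push_cast
    ring
  · filter_upwards with t
    exact (hec.mul ((expSymb n l hl).continuous.comp (continuous_const_smul t))).aestronglyMeasurable
  · refine (hint (expSymb n l hl) hs.ne').bdd_mul hec.aestronglyMeasurable
      (c := 1) (ae_of_all _ fun v ↦ (Complex.norm_exp_ofReal_mul_I _).le)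
  · have hc : Continuous (symb n l) := (symb_hasTemperateGrowth n l).1.continuous
    exact (hec.mul (by fun_prop)).aestronglyMeasurable
  · refine ae_of_all _ fun v t ht ↦ ?_
    have ht0 : 0 < t := by linarith [ht.1]
    have h1 : (s / 2) ^ (2 * l) * symb n l v ≤ t ^ (2 * l) * symb n l v :=
      mul_le_mul_of_nonneg_right (pow_le_pow_left₀ (by positivity) ht.1.le _) (symb_nonneg _ _ _)
    have h2 : t ^ (2 * l - 1) ≤ (2 * s) ^ (2 * l - 1) := pow_le_pow_left₀ ht0.le ht.2.le _
    have h3 := symb_nonneg n l v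
    rw [norm_mul, he, Complex.norm_exp_ofReal_mul_I, one_mul, hsm, Complex.norm_real, Complex.norm_real,
      Real.norm_eq_abs, Real.norm_eq_abs, symb_smul, symb_smul, abs_mul, abs_neg, Real.abs_exp,
      abs_of_nonneg (by positivity), abs_of_nonneg (by positivity)]
    calc 2 * l * t ^ (2 * l - 1) * symb n l v * Real.exp (-(t ^ (2 * l) * symb n l v))
        ≤ 2 * l * (2 * s) ^ (2 * l - 1) * symb n l v *
          Real.exp (-((s / 2) ^ (2 * l) * symb n l v)) := by gcongr
      _ = _ := by field_simp
  · exact ((hint _ (by positivity : s / 2 ≠ 0)).norm).const_mul _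
  · refine ae_of_all _ fun v t ht ↦ ?_
    simp only [expSymb_apply, symb_smul]
    have h : HasDerivAt (fun t : ℝ ↦ ((Real.exp (-(t ^ (2 * l) * symb n l v)) : ℝ) : ℂ))
        ((Real.exp (-(t ^ (2 * l) * symb n l v)) *
          -(((2 * l : ℕ) : ℝ) * t ^ (2 * l - 1) * symb n l v) : ℝ) : ℂ) t :=
      (((hasDerivAt_pow (2 * l) t).mul_const _).neg.exp).ofReal_comp
    refine (h.const_mul (e v)).congr_deriv ?_
    push_cast
    ring

/-! ### Bumps and averages at a given scale -/

/-- The polynomially decaying bump of width `s` and height `s⁻ⁿ`. -/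
noncomputable def bump {n : ℕ} (a : ℕ) (s : ℝ) (z : Space n) : ℝ :=
  (s ^ n)⁻¹ * ((1 + s⁻¹ * ‖z‖) ^ a)⁻¹

theorem bump_nonneg {n a : ℕ} {s : ℝ} (hs : 0 < s) (z : Space n) : 0 ≤ bump a s z := by
  unfold bump; positivity

@[fun_prop]
theorem measurable_bump {n a : ℕ} : Measurable fun p : ℝ × Space n ↦ bump a p.1 p.2 := by
  unfold bump; fun_prop

theorem integrable_bump_one (n : ℕ) : Integrable (bump (n := n) (n + 1) 1) := by
  have h := integrable_one_add_norm (E := Space n) (μ := volume) (r := (n + 1 : ℕ)) (by simp)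
  refine h.congr (ae_of_all _ fun z ↦ ?_)
  simp only [bump, one_pow, inv_one, one_mul]
  rw [Real.rpow_neg (by positivity), Real.rpow_natCast]

theorem integrable_bump {n : ℕ} {s : ℝ} (hs : 0 < s) (y : Space n) :
    Integrable fun x : Space n ↦ bump (n + 1) s (x - y) := by
  have h := (((integrable_bump_one n).comp_smul (inv_ne_zero hs.ne')).const_mul
    ((s ^ n)⁻¹)).comp_sub_right y
  refine h.congr (ae_of_all _ fun z ↦ ?_)
  simp [bump, norm_smul, abs_of_pos hs]

theorem integral_bump {n : ℕ} {s : ℝ} (hs : 0 < s) (y : Space n) :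
    ∫ x : Space n, bump (n + 1) s (x - y) = ∫ x : Space n, bump (n + 1) 1 x := by
  rw [integral_sub_right_eq_self (bump (n + 1) s)]
  have h := Measure.integral_comp_smul (volume : Measure (Space n)) (bump (n + 1) 1) s⁻¹
  rw [finrank_euclideanSpace_fin, abs_of_pos (by positivity)] at h
  have h2 : ∀ x : Space n, bump (n + 1) s x = (s ^ n)⁻¹ * bump (n + 1) 1 (s⁻¹ • x) := fun x ↦ by
    simp [bump, norm_smul, abs_of_pos hs]
  simp_rw [h2]
  rw [integral_const_mul, h, smul_eq_mul, ← mul_assoc, inv_pow, inv_inv,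
    inv_mul_cancel₀ (by positivity), one_mul]

/-- The mass of the bumps. -/
noncomputable def bumpMass (n : ℕ) : ℝ≥0∞ := ENNReal.ofReal (∫ x : Space n, bump (n + 1) 1 x)

theorem bumpMass_ne_top (n : ℕ) : bumpMass n ≠ ∞ := ENNReal.ofReal_ne_top

theorem lintegral_bump {n : ℕ} {s : ℝ} (hs : 0 < s) (y : Space n) :
    ∫⁻ x : Space n, ENNReal.ofReal (bump (n + 1) s (x - y)) = bumpMass n := by
  rw [← ofReal_integral_eq_lintegral_ofReal (integrable_bump hs y)
    (ae_of_all _ fun x ↦ bump_nonneg hs _), integral_bump hs, bumpMass]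

theorem lintegral_bump' {n : ℕ} {s : ℝ} (hs : 0 < s) (x : Space n) :
    ∫⁻ y : Space n, ENNReal.ofReal (bump (n + 1) s (x - y)) = bumpMass n := by
  rw [← lintegral_bump hs x]
  refine lintegral_congr fun y ↦ ?_
  simp only [bump, norm_sub_rev]

theorem bump_two_mul_le {n a : ℕ} {s : ℝ} (hs : 0 < s) (z : Space n) :
    bump (2 * a) s z ≤ bump a s z := by
  unfold bump
  have : 1 ≤ 1 + s⁻¹ * ‖z‖ := by have : 0 ≤ s⁻¹ * ‖z‖ := by positivity
                                 linarith
  gcongr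
  omega

theorem bump_le_inv_pow {n a : ℕ} {s : ℝ} (hs : 0 < s) (z : Space n) : bump a s z ≤ (s ^ n)⁻¹ := by
  unfold bump
  refine mul_le_of_le_one_right (by positivity) (inv_le_one_of_one_le₀ (one_le_pow₀ ?_))
  have : 0 ≤ s⁻¹ * ‖z‖ := by positivity
  linarith

/-- A Peetre-type inequality: since s ≤ t, 1 + |x-z|/t ≤ (1 + |x-y|/s)(1 + |y-z|/t). Half of the
exponent 2a pays for recentring the wide bump, and the other half stays integrable in the
application. -/
theorem bump_mul_bump_le {n a : ℕ} {s t : ℝ} (hs : 0 < s) (hst : s ≤ t) (x y z : Space n) :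
    bump a t (y - z) * bump (2 * a) s (x - y) ≤ bump a t (x - z) * bump a s (x - y) := by
  have ht : 0 < t := hs.trans_le hst
  have h : 1 + t⁻¹ * ‖x - z‖ ≤ (1 + s⁻¹ * ‖x - y‖) * (1 + t⁻¹ * ‖y - z‖) := by
    have h1 : ‖x - z‖ ≤ ‖x - y‖ + ‖y - z‖ := norm_sub_le_norm_sub_add_norm_sub x y z
    have h2 : t⁻¹ * ‖x - z‖ ≤ t⁻¹ * ‖x - y‖ + t⁻¹ * ‖y - z‖ := by
      rw [← mul_add]; gcongr
    have h3 : t⁻¹ * ‖x - y‖ ≤ s⁻¹ * ‖x - y‖ := by gcongr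
    have h4 : 0 ≤ (s⁻¹ * ‖x - y‖) * (t⁻¹ * ‖y - z‖) := by positivity
    nlinarith
  have h' : ((1 + s⁻¹ * ‖x - y‖) ^ a * (1 + t⁻¹ * ‖y - z‖) ^ a)⁻¹ ≤ ((1 + t⁻¹ * ‖x - z‖) ^ a)⁻¹ := by
    rw [← mul_pow]
    gcongr
  unfold bump
  calc _ = (t ^ n)⁻¹ * (s ^ n)⁻¹ * ((1 + s⁻¹ * ‖x - y‖) ^ a)⁻¹ *
        ((1 + s⁻¹ * ‖x - y‖) ^ a * (1 + t⁻¹ * ‖y - z‖) ^ a)⁻¹ := by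
        rw [two_mul, pow_add, mul_inv, mul_inv]; ring
    _ ≤ (t ^ n)⁻¹ * (s ^ n)⁻¹ * ((1 + s⁻¹ * ‖x - y‖) ^ a)⁻¹ * ((1 + t⁻¹ * ‖x - z‖) ^ a)⁻¹ := by
        gcongr
    _ = _ := by ring

theorem exists_schwartz_bound {n : ℕ} (f : 𝓢(Space n, ℂ)) (a : ℕ) :
    ∃ C : ℝ, 0 ≤ C ∧ ∀ w, ‖f w‖ ≤ C * ((1 + ‖w‖) ^ a)⁻¹ := by
  refine ⟨2 ^ a * (Finset.Iic (a, 0)).sup (fun m ↦ SchwartzMap.seminorm ℂ m.1 m.2) f,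
    by positivity, fun w ↦ ?_⟩
  rw [← div_eq_mul_inv, le_div_iff₀ (by positivity), mul_comm]
  simpa using f.one_add_le_sup_seminorm_apply (𝕜 := ℂ) (m := (a, 0)) (k := a) (n := 0) le_rfl
    le_rfl w

/-- The shape matters: one factor |x - y| will supply a power of s, polynomial growth in x - y is
paid for by kernel decay, and 1 + |y|^m is absorbed by the exponential weight through
`one_add_mul_exp_le`. -/
theorem abs_norm_pow_sub_le {n : ℕ} (m : ℕ) (x y : Space n) :
    |‖x‖ ^ m - ‖y‖ ^ m| ≤ m * 2 ^ m * ‖x - y‖ * (1 + ‖x - y‖) ^ m * (1 + ‖y‖ ^ m) := by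
  have hx : ‖x‖ ≤ (1 + ‖x - y‖) * (1 + ‖y‖) := by
    have : ‖x‖ ≤ ‖x - y‖ + ‖y‖ := by simpa using norm_add_le (x - y) y
    nlinarith [norm_nonneg (x - y), norm_nonneg y, mul_nonneg (norm_nonneg (x - y)) (norm_nonneg y)]
  have hy : ‖y‖ ≤ (1 + ‖x - y‖) * (1 + ‖y‖) := by
    nlinarith [norm_nonneg (x - y), norm_nonneg y, mul_nonneg (norm_nonneg (x - y)) (norm_nonneg y)]
  have h1 : 1 ≤ (1 + ‖x - y‖) * (1 + ‖y‖) := by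
    nlinarith [norm_nonneg (x - y), norm_nonneg y, mul_nonneg (norm_nonneg (x - y)) (norm_nonneg y)]
  have h2 : (1 + ‖y‖) ^ m ≤ 2 ^ m * (1 + ‖y‖ ^ m) := by
    have := add_pow_le (zero_le_one' ℝ) (norm_nonneg y) m
    rw [one_pow] at this
    refine this.trans ?_
    gcongr
    · norm_num
    · omega
  calc |‖x‖ ^ m - ‖y‖ ^ m| ≤ |‖x‖ - ‖y‖| * m * max |‖x‖| |‖y‖| ^ (m - 1) :=
        abs_pow_sub_pow_le _ _ _
    _ ≤ ‖x - y‖ * m * ((1 + ‖x - y‖) * (1 + ‖y‖)) ^ m := by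
        gcongr
        · exact abs_norm_sub_norm_le x y
        · refine (pow_le_pow_left₀ (by positivity) (max_le ?_ ?_) _).trans
            (pow_le_pow_right₀ h1 (Nat.sub_le m 1))
          · rwa [abs_norm]
          · rwa [abs_norm]
    _ = ‖x - y‖ * m * (1 + ‖x - y‖) ^ m * (1 + ‖y‖) ^ m := by rw [mul_pow]; ring
    _ ≤ ‖x - y‖ * m * (1 + ‖x - y‖) ^ m * (2 ^ m * (1 + ‖y‖ ^ m)) := by gcongr
    _ = _ := by ring

theorem one_add_mul_exp_le {s V : ℝ} (hs : 0 < s) (hs1 : s ≤ 1) (hV : 0 ≤ V) :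
    s * ((1 + V) * Real.exp (-(s * V))) ≤ 2 := by
  have h1 : Real.exp (-(s * V)) ≤ 1 := Real.exp_le_one_iff.2 (by nlinarith)
  have h2 : s * V * Real.exp (-(s * V)) ≤ 1 := by
    have := Real.add_one_le_exp (s * V)
    rw [Real.exp_neg, ← div_eq_mul_inv, div_le_one (Real.exp_pos _)]
    linarith
  nlinarith [Real.exp_pos (-(s * V))]

/-- From |b| ≤ 1 + |b|² and the height s^{-n} of the bump. This produces the starting exponent n of
the bootstrap out of the L² norm. -/
theorem norm_mul_bump_le {n : ℕ} {s : ℝ} (hs : 0 < s) (b : ℂ) (z : Space n) :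
    ‖b‖ * bump (n + 1) s z ≤ bump (n + 1) s z + (s ^ n)⁻¹ * ‖b‖ ^ 2 := by
  have h1 := bump_nonneg (a := n + 1) hs z
  have h2 := bump_le_inv_pow (a := n + 1) hs z
  have h3 : ‖b‖ * bump (n + 1) s z ≤ bump (n + 1) s z + ‖b‖ ^ 2 * bump (n + 1) s z := by
    nlinarith [norm_nonneg b, sq_nonneg (‖b‖ - 1)]
  nlinarith [sq_nonneg ‖b‖]

theorem integrable_mul_bump {n : ℕ} {u : Space n → ℂ} (hu : MemLp u 2) {s : ℝ} (hs : 0 < s)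
    (y : Space n) : Integrable fun x ↦ ‖u x‖ * bump (n + 1) s (x - y) := by
  have h2 : Integrable fun x ↦ ‖u x‖ ^ 2 := hu.integrable_norm_pow (by norm_num)
  refine ((integrable_bump hs y).add (h2.const_mul (s ^ n)⁻¹)).mono'
    (hu.1.norm.mul (integrable_bump hs y).1) (ae_of_all _ fun x ↦ ?_)
  rw [Real.norm_of_nonneg (mul_nonneg (norm_nonneg _) (bump_nonneg hs _))]
  exact norm_mul_bump_le hs _ _

/-- The average of `|u|` against the bump of width `s` around `y`. -/
noncomputable def average {n : ℕ} (u : Space n → ℂ) (s : ℝ) (y : Space n) : ℝ≥0∞ :=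
  ∫⁻ x, ‖u x‖ₑ * ENNReal.ofReal (bump (n + 1) s (x - y))

theorem average_le {n : ℕ} {u : Space n → ℂ} (hu : MemLp u 2) {s : ℝ} (hs : 0 < s)
    (y : Space n) : average u s y
      ≤ bumpMass n + ENNReal.ofReal ((s ^ n)⁻¹) * ∫⁻ x, ‖u x‖ₑ ^ 2 := by
  rw [← lintegral_bump hs y, ← lintegral_const_mul'' _ (hu.1.enorm.pow_const 2),
    ← lintegral_add_left' (integrable_bump hs y).1.aemeasurable.ennreal_ofReal]
  refine lintegral_mono fun x ↦ ?_
  simp only [← ofReal_norm]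
  rw [← ENNReal.ofReal_mul (norm_nonneg _), ← ENNReal.ofReal_pow (norm_nonneg _),
    ← ENNReal.ofReal_mul (by positivity), ← ENNReal.ofReal_add (bump_nonneg hs _) (by positivity)]
  exact ENNReal.ofReal_le_ofReal (norm_mul_bump_le hs _ _)

theorem lintegral_sq_lt_top {n : ℕ} {u : Space n → ℂ} (hu : MemLp u 2) :
    ∫⁻ x, ‖u x‖ₑ ^ 2 < ∞ := by
  have h := lintegral_rpow_enorm_lt_top_of_eLpNorm_lt_top (p := 2) (by simp) (by simp) hu.2
  simpa using h

/-! ### Weak form of the eigenvalue equation -/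

theorem oscillator_apply {n k l : ℕ} (v : 𝓢'(Space n, ℂ)) (φ : 𝓢(Space n, ℂ)) :
    oscillator n k l v φ = v (negLap l φ) + v (SchwartzMap.smulLeftCLM ℂ (potential n k) φ)
      + v φ := by
  have h : ∀ (l : ℕ) (φ : 𝓢(Space n, ℂ)),
      ((fun w : 𝓢'(Space n, ℂ) ↦ -Δ w)^[l] v) φ = v (negLap l φ) := by
    intro l
    induction l with
    | zero => intro φ; rfl
    | succ l ih =>
      intro φ
      rw [Function.iterate_succ_apply', negLap, Function.iterate_succ_apply, ← negLap, ← ih]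
      change -(Δ ((fun w : 𝓢'(Space n, ℂ) ↦ -Δ w)^[l] v)) φ = _
      rw [TemperedDistribution.laplacian_apply_apply, ← map_neg]
  rw [← h]
  rfl

theorem integrable_mul_schwartz {n : ℕ} {u : Space n → ℂ} (hu : MemLp u 2) (φ : 𝓢(Space n, ℂ)) :
    Integrable fun x ↦ u x * φ x :=
  hu.integrable_mul (φ.memLp 2)

/-- `u` solves `(-Δ)^l u + |x|^{2k} u = c u` in the sense of tempered distributions. -/
def IsWeakSolution {n : ℕ} (k l : ℕ) (u : Space n → ℂ) (c : ℂ) : Prop :=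
  ∀ φ : 𝓢(Space n, ℂ), ∫ x, u x * negLap l φ x = ∫ x, u x * ((c - potential n k x) * φ x)

theorem IsEigenfunction.isWeakSolution {n k l : ℕ} {v : L2 n} {μ : ℂ}
    (h : IsEigenfunction k l v μ) : IsWeakSolution k l v (μ - 1) := by
  intro φ
  have h1 := DFunLike.congr_fun h.2 φ
  rw [oscillator_apply] at h1
  change _ = μ • (v : 𝓢'(Space n, ℂ)) φ at h1
  simp only [Lp.toTemperedDistribution_apply, smul_eq_mul] at h1
  have hv := Lp.memLp v
  have e1 := integrable_mul_schwartz hv φ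
  have e2 := integrable_mul_schwartz hv (SchwartzMap.smulLeftCLM ℂ (potential n k) φ)
  have h2 : ∀ x, v x * ((μ - 1 - potential n k x) * φ x)
      = (μ - 1) * (v x * φ x) - v x * SchwartzMap.smulLeftCLM ℂ (potential n k) φ x := fun x ↦ by
    rw [SchwartzMap.smulLeftCLM_apply_apply (potential_hasTemperateGrowth n k), smul_eq_mul]
    ring
  simp_rw [h2]
  rw [integral_sub (e1.const_mul _) e2, integral_const_mul]
  simp_rw [mul_comm (v _)]
  linear_combination h1

/-- The dilated kernel, centred at `y`. -/
noncomputable def dilated {n : ℕ} (f : 𝓢(Space n, ℂ)) (s : ℝ) (y x : Space n) : ℂ :=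
  ((s ^ n)⁻¹ : ℝ) * f (s⁻¹ • (x - y))

theorem norm_dilated_le {n : ℕ} {f : 𝓢(Space n, ℂ)} {a : ℕ} {C : ℝ}
    (hC : ∀ w, ‖f w‖ ≤ C * ((1 + ‖w‖) ^ a)⁻¹) {s : ℝ} (hs : 0 < s) (y x : Space n) :
    ‖dilated f s y x‖ ≤ C * bump a s (x - y) := by
  rw [dilated, norm_mul, Complex.norm_real, Real.norm_of_nonneg (by positivity), bump,
    mul_left_comm]
  have := hC (s⁻¹ • (x - y))
  rw [norm_smul, norm_inv, Real.norm_of_nonneg hs.le] at this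
  gcongr

theorem measurable_dilated {n : ℕ} (f : 𝓢(Space n, ℂ)) (y : Space n) :
    Measurable fun p : ℝ × Space n ↦ dilated f p.1 y p.2 := by
  have := f.continuous.measurable
  unfold dilated
  fun_prop

theorem continuousOn_dilated {n : ℕ} (f : 𝓢(Space n, ℂ)) (y x : Space n) :
    ContinuousOn (fun s : ℝ ↦ dilated f s y x) (Set.Ioi 0) := by
  intro s hs
  have hs' : s ≠ 0 := (Set.mem_Ioi.1 hs).ne'
  have h1 : ContinuousAt (fun s : ℝ ↦ s⁻¹ • (x - y)) s := (continuousAt_inv₀ hs').smul_const _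
  have h2 : ContinuousAt (fun s : ℝ ↦ f (s⁻¹ • (x - y))) s :=
    f.continuous.continuousAt.comp h1
  have h3 : ContinuousAt (fun s : ℝ ↦ (((s ^ n)⁻¹ : ℝ) : ℂ)) s :=
    Complex.continuous_ofReal.continuousAt.comp
      (((continuous_pow n).continuousAt).inv₀ (pow_ne_zero n hs'))
  exact (h3.mul h2).continuousWithinAt

theorem integrable_mul_dilated {n : ℕ} {u : Space n → ℂ} (hu : MemLp u 2) (f : 𝓢(Space n, ℂ))
    {s : ℝ} (hs : 0 < s) (y : Space n) : Integrable fun x ↦ u x * dilated f s y x := by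
  have h := (integrable_mul_schwartz hu (rescale s⁻¹ (inv_ne_zero hs.ne') y f)).const_mul
    (((s ^ n)⁻¹ : ℝ) : ℂ)
  refine h.congr (ae_of_all _ fun x ↦ ?_)
  simp only [dilated, rescale_apply]
  ring

theorem IsWeakSolution.integral_dilated {n k l : ℕ} {u : Space n → ℂ} {c : ℂ}
    (h : IsWeakSolution k l u c) (f : 𝓢(Space n, ℂ)) {s : ℝ} (hs : 0 < s) (y : Space n) :
    ∫ x, u x * dilated (negLap l f) s y x
      = s ^ (2 * l) * ∫ x, u x * ((c - potential n k x) * dilated f s y x) := by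
  have h1 := h (rescale s⁻¹ (inv_ne_zero hs.ne') y f)
  rw [negLap_rescale] at h1
  have hs' : (s : ℂ) ≠ 0 := by exact_mod_cast hs.ne'
  have e1 : ∀ x, u x * dilated (negLap l f) s y x = (s ^ (2 * l) * ((s ^ n)⁻¹ : ℝ)) *
      (u x * (((s⁻¹ : ℝ) : ℂ) ^ (2 * l) • rescale s⁻¹ (inv_ne_zero hs.ne') y (negLap l f)) x) := by
    intro x
    have e : (s : ℂ) ^ (2 * l) * ((s⁻¹ : ℝ) : ℂ) ^ (2 * l) = 1 := by
      rw [Complex.ofReal_inv, ← mul_pow, mul_inv_cancel₀ hs', one_pow]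
    simp only [dilated, smul_apply, rescale_apply, smul_eq_mul]
    linear_combination (-u x * ((s ^ n)⁻¹ : ℝ) * negLap l f (s⁻¹ • (x - y))) * e
  have e2 : ∀ x, u x * ((c - potential n k x) * dilated f s y x) = ((s ^ n)⁻¹ : ℝ) *
      (u x * ((c - potential n k x) * rescale s⁻¹ (inv_ne_zero hs.ne') y f x)) := by
    intro x
    simp only [dilated, rescale_apply]
    ring
  simp_rw [e1, e2]
  rw [integral_const_mul, integral_const_mul, h1]
  ring

/-! ### Duhamel formula with frozen potential -/

/-- The frozen coefficient heat kernel, as a function of the width `s` and of `x`. -/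
noncomputable def frozen {n : ℕ} (l : ℕ) (hl : 1 ≤ l) (V : ℝ) (y : Space n) (s : ℝ) (x : Space n) :
    ℂ :=
  (Real.exp (-(s ^ (2 * l) * V)) : ℝ) * dilated (kernel n l hl) s y x

/-- The derivative of `frozen` in `s`. -/
noncomputable def frozenDeriv {n : ℕ} (l : ℕ) (hl : 1 ≤ l) (V : ℝ) (y : Space n) (s : ℝ)
    (x : Space n) : ℂ :=
  (-(2 * l * Real.exp (-(s ^ (2 * l) * V))) : ℝ) *
    ((s ^ (2 * l - 1) * V : ℝ) * dilated (kernel n l hl) s y x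
      + (s⁻¹ : ℝ) * dilated (negLap l (kernel n l hl)) s y x)

theorem hasDerivAt_frozen {n l : ℕ} (hl : 1 ≤ l) (V : ℝ) (y : Space n) {s : ℝ} (hs : 0 < s)
    (x : Space n) :
    HasDerivAt (fun s ↦ frozen l hl V y s x) (frozenDeriv l hl V y s x) s := by
  have h1 := hasDerivAt_dilation_kernel hl hs (x - y)
  have h2 : HasDerivAt (fun t : ℝ ↦ ((Real.exp (-(t ^ (2 * l) * V)) : ℝ) : ℂ))
      ((Real.exp (-(s ^ (2 * l) * V)) * -(((2 * l : ℕ) : ℝ) * s ^ (2 * l - 1) * V) : ℝ) : ℂ) s :=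
    (((hasDerivAt_pow (2 * l) s).mul_const _).neg.exp).ofReal_comp
  refine (h2.mul h1).congr_deriv ?_
  simp only [frozenDeriv, dilated]
  push_cast
  ring

theorem measurable_frozenDeriv {n l : ℕ} (hl : 1 ≤ l) (V : ℝ) (y : Space n) :
    Measurable fun p : ℝ × Space n ↦ frozenDeriv l hl V y p.1 p.2 := by
  have h1 := measurable_dilated (kernel n l hl) y
  have h2 := measurable_dilated (negLap l (kernel n l hl)) y
  unfold frozenDeriv
  fun_prop

theorem continuousOn_frozenDeriv {n l : ℕ} (hl : 1 ≤ l) (V : ℝ) (y x : Space n) :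
    ContinuousOn (fun s ↦ frozenDeriv l hl V y s x) (Set.Ioi 0) := by
  have h1 := continuousOn_dilated (kernel n l hl) y x
  have h2 := continuousOn_dilated (negLap l (kernel n l hl)) y x
  have h3 : ContinuousOn (fun s : ℝ ↦ ((s⁻¹ : ℝ) : ℂ)) (Set.Ioi 0) :=
    Complex.continuous_ofReal.comp_continuousOn
      (continuousOn_inv₀.mono fun s hs ↦ (Set.mem_Ioi.1 hs).ne')
  have h4 : Continuous fun s : ℝ ↦ ((-(2 * l * Real.exp (-(s ^ (2 * l) * V))) : ℝ) : ℂ) := by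
    fun_prop
  have h5 : Continuous fun s : ℝ ↦ ((s ^ (2 * l - 1) * V : ℝ) : ℂ) := by fun_prop
  exact h4.continuousOn.mul ((h5.continuousOn.mul h1).add (h3.mul h2))

theorem frozen_sub_frozen {n l : ℕ} (hl : 1 ≤ l) (V : ℝ) (y : Space n) {ε : ℝ} (hε : 0 < ε)
    (hε1 : ε ≤ 1) (x : Space n) :
    frozen l hl V y 1 x - frozen l hl V y ε x
      = ∫ s in Set.Ioc ε 1, frozenDeriv l hl V y s x := by
  rw [← intervalIntegral.integral_of_le hε1]
  have hsub : Set.uIcc ε 1 ⊆ Set.Ioi 0 := fun s hs ↦ by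
    rw [Set.uIcc_of_le hε1] at hs
    exact hε.trans_le hs.1
  exact (intervalIntegral.integral_eq_sub_of_hasDerivAt
    (fun s hs ↦ hasDerivAt_frozen hl V y (hsub hs) x)
    ((continuousOn_frozenDeriv hl V y x).mono hsub).intervalIntegrable).symm

/-- The weak equation trades (-Δ)^l on the kernel for c - |x|^{2k} at the cost of s^{2l}. Combined
with the prefactor s⁻¹ this matches the power s^{2l-1} in front of V, so the two terms merge. -/
theorem IsWeakSolution.integral_frozenDeriv {n k l : ℕ} (hl : 1 ≤ l) {u : Space n → ℂ}
    (hu : MemLp u 2) {c : ℂ} (h : IsWeakSolution k l u c) (V : ℝ) (y : Space n) {s : ℝ}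
    (hs : 0 < s) :
    ∫ x, u x * frozenDeriv l hl V y s x = ∫ x, u x *
      ((-(2 * l * s ^ (2 * l - 1) * Real.exp (-(s ^ (2 * l) * V))) : ℝ) *
      ((V + c - potential n k x) * dilated (kernel n l hl) s y x)) := by
  have h1 := integrable_mul_dilated hu (kernel n l hl) hs y
  have h2 := integrable_mul_dilated hu (negLap l (kernel n l hl)) hs y
  have h3 : Integrable fun x ↦ u x * ((c - potential n k x) * dilated (kernel n l hl) s y x) := by
    -- In the variable w = (x - y)/s the potential still has temperate growth, so its product with
    -- the kernel is again a Schwartz function.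
    have e := integrable_mul_dilated hu (SchwartzMap.smulLeftCLM ℂ
      (fun w ↦ c - potential n k (s • w + y)) (kernel n l hl)) hs y
    refine e.congr (ae_of_all _ fun x ↦ ?_)
    have hp : Function.HasTemperateGrowth fun w ↦ c - potential n k (s • w + y) := by
      have := potential_hasTemperateGrowth n k
      exact (Function.HasTemperateGrowth.const c).sub
        (this.comp (f := fun w ↦ s • w + y) (by fun_prop))
    simp only [dilated]
    rw [SchwartzMap.smulLeftCLM_apply_apply hp, smul_inv_smul₀ hs.ne', sub_add_cancel, smul_eq_mul]
    ring
  have e1 : ∀ x, u x * frozenDeriv l hl V y s x =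
      (-(2 * l * Real.exp (-(s ^ (2 * l) * V))) : ℝ) * ((s ^ (2 * l - 1) * V : ℝ) *
        (u x * dilated (kernel n l hl) s y x)
      + (s⁻¹ : ℝ) * (u x * dilated (negLap l (kernel n l hl)) s y x)) := fun x ↦ by
    rw [frozenDeriv]; ring
  have e2 : ∀ x, u x *
      ((-(2 * l * s ^ (2 * l - 1) * Real.exp (-(s ^ (2 * l) * V))) : ℝ) *
      ((V + c - potential n k x) * dilated (kernel n l hl) s y x))
      = (-(2 * l * s ^ (2 * l - 1) * Real.exp (-(s ^ (2 * l) * V))) : ℝ) *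
      (V * (u x * dilated (kernel n l hl) s y x) +
        u x * ((c - potential n k x) * dilated (kernel n l hl) s y x)) := fun x ↦ by ring
  simp_rw [e1, e2]
  rw [integral_const_mul, integral_const_mul, integral_add (h1.const_mul _) (h2.const_mul _),
    integral_add (h1.const_mul _) h3, integral_const_mul, integral_const_mul, integral_const_mul,
    h.integral_dilated _ hs]
  have : s ^ (2 * l) = s ^ (2 * l - 1) * s := by rw [← pow_succ]; congr 1; omega
  have hs' : (s : ℂ) ≠ 0 := by exact_mod_cast hs.ne'
  have this' : (s : ℂ) ^ (2 * l) = s ^ (2 * l - 1) * s := by exact_mod_cast this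
  rw [this']
  push_cast
  field_simp

theorem norm_potential_sub_le {n : ℕ} (k : ℕ) (c : ℂ) (x y : Space n) :
    ‖((‖y‖ ^ (2 * k) : ℝ) : ℂ) + c - potential n k x‖
      ≤ ((2 * k : ℕ) * 2 ^ (2 * k)) * ‖x - y‖ * (1 + ‖x - y‖) ^ (2 * k) * (1 + ‖y‖ ^ (2 * k))
        + ‖c‖ := by
  have h := abs_norm_pow_sub_le (2 * k) x y
  have e : ((‖y‖ ^ (2 * k) : ℝ) : ℂ) + c - potential n k x
      = c - ((‖x‖ ^ (2 * k) - ‖y‖ ^ (2 * k) : ℝ) : ℂ) := by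
    rw [potential]; push_cast; ring
  rw [e]
  refine (norm_sub_le _ _).trans ?_
  rw [Complex.norm_real, Real.norm_eq_abs]
  linarith

/-- With r = |x - y|/s, the factor |x - y| = s r raises s^{2l-1} to s^{2l}, and s^{2l}(1 +
V)e^{-s^{2l}V} ≤ 2 removes the dependence on V. The term with c needs only s ≤ 1. -/
theorem exists_error_kernel_bound (n k l : ℕ) (hl : 1 ≤ l) (c : ℂ) :
    ∃ C : ℝ, 0 ≤ C ∧ ∀ (s : ℝ), 0 < s → s ≤ 1 → ∀ x y : Space n,
      ‖((-(2 * l * s ^ (2 * l - 1) * Real.exp (-(s ^ (2 * l) * ‖y‖ ^ (2 * k)))) : ℝ) : ℂ) *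
      ((((‖y‖ ^ (2 * k) : ℝ) : ℂ) + c - potential n k x) * dilated (kernel n l hl) s y x)‖
        ≤ C * bump (2 * (n + 1)) s (x - y) := by
  -- The extra decay 2k + 1 pays for r(1 + r)^{2k}; the exponent 2(n + 1) survives in the bump.
  obtain ⟨C, hC0, hC⟩ := exists_schwartz_bound (kernel n l hl) (2 * (n + 1) + (2 * k + 1))
  set A : ℝ := (2 * k : ℕ) * 2 ^ (2 * k) with hA
  have hA0 : 0 ≤ A := by positivity
  refine ⟨2 * l * (2 * A + ‖c‖) * C, by positivity, fun s hs hs1 x y ↦ ?_⟩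
  have h1 := norm_potential_sub_le k c x y
  have h2 := norm_dilated_le hC hs y x
  rw [← hA] at h1
  set V := ‖y‖ ^ (2 * k) with hV
  have hV0 : 0 ≤ V := by positivity
  set E := Real.exp (-(s ^ (2 * l) * V)) with hE
  have hE0 : 0 < E := Real.exp_pos _
  have hE1 : E ≤ 1 := Real.exp_le_one_iff.2 (neg_nonpos.2 (by positivity))
  have h3 : s ^ (2 * l) * ((1 + V) * E) ≤ 2 :=
    one_add_mul_exp_le (by positivity) (pow_le_one₀ hs.le hs1) hV0
  set r := s⁻¹ * ‖x - y‖ with hr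
  have hr0 : 0 ≤ r := by positivity
  have hz : ‖x - y‖ = s * r := by rw [hr, mul_inv_cancel_left₀ hs.ne']
  have hzr : ‖x - y‖ ≤ r := by rw [hz]; exact mul_le_of_le_one_left hr0 hs1
  have hpow : s ^ (2 * l - 1) * s = s ^ (2 * l) := by rw [← pow_succ]; congr 1; omega
  have hpow1 : s ^ (2 * l - 1) ≤ 1 := pow_le_one₀ hs.le hs1
  have h4 : s ^ (2 * l - 1) * E * (A * ‖x - y‖ * (1 + ‖x - y‖) ^ (2 * k) * (1 + V) + ‖c‖)
      ≤ (2 * A + ‖c‖) * (1 + r) ^ (2 * k + 1) := by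
    have e1 : s ^ (2 * l - 1) * E * (A * ‖x - y‖ * (1 + ‖x - y‖) ^ (2 * k) * (1 + V))
        ≤ 2 * A * (1 + r) ^ (2 * k + 1) := by
      calc _ = A * (r * (1 + ‖x - y‖) ^ (2 * k)) * (s ^ (2 * l) * ((1 + V) * E)) := by
            rw [← hpow]; nth_rewrite 1 [hz]; ring
        _ ≤ A * ((1 + r) * (1 + r) ^ (2 * k)) * 2 := by
            gcongr
            linarith
        _ = _ := by ring
    have e2 : s ^ (2 * l - 1) * E * ‖c‖ ≤ ‖c‖ * (1 + r) ^ (2 * k + 1) := by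
      have : 1 ≤ (1 + r) ^ (2 * k + 1) := one_le_pow₀ (by linarith)
      calc s ^ (2 * l - 1) * E * ‖c‖ ≤ 1 * 1 * ‖c‖ := by gcongr
        _ ≤ _ := by nlinarith [norm_nonneg c]
    linarith [mul_add (s ^ (2 * l - 1) * E)
      (A * ‖x - y‖ * (1 + ‖x - y‖) ^ (2 * k) * (1 + V)) ‖c‖]
  rw [norm_mul, norm_mul, Complex.norm_real, norm_neg, Real.norm_of_nonneg (by positivity)]
  have hb : (1 + r) ^ (2 * k + 1) * bump (2 * (n + 1) + (2 * k + 1)) s (x - y)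
      = bump (2 * (n + 1)) s (x - y) := by
    unfold bump
    rw [← hr, pow_add (1 + r) (2 * (n + 1))]
    have : (1 + r) ≠ 0 := by positivity
    field_simp
  have hb0 := bump_nonneg (a := 2 * (n + 1) + (2 * k + 1)) hs (x - y)
  calc _ ≤ 2 * l * s ^ (2 * l - 1) * E *
        ((A * ‖x - y‖ * (1 + ‖x - y‖) ^ (2 * k) * (1 + V) + ‖c‖) *
          (C * bump (2 * (n + 1) + (2 * k + 1)) s (x - y))) := by gcongr
    _ = 2 * l * (s ^ (2 * l - 1) * E *
        (A * ‖x - y‖ * (1 + ‖x - y‖) ^ (2 * k) * (1 + V) + ‖c‖)) *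
          (C * bump (2 * (n + 1) + (2 * k + 1)) s (x - y)) := by ring
    _ ≤ 2 * l * ((2 * A + ‖c‖) * (1 + r) ^ (2 * k + 1)) *
          (C * bump (2 * (n + 1) + (2 * k + 1)) s (x - y)) := by gcongr
    _ = 2 * l * (2 * A + ‖c‖) * C *
          ((1 + r) ^ (2 * k + 1) * bump (2 * (n + 1) + (2 * k + 1)) s (x - y)) := by ring
    _ = _ := by rw [hb]

/-- Licenses Fubini in the Duhamel formula. Staying above ε > 0 avoids the singularity s⁻¹ and lets
one bump of width 1 dominate all widths. -/
theorem integrable_uncurry_frozenDeriv {n l : ℕ} (hl : 1 ≤ l) {u : Space n → ℂ} (hu : MemLp u 2)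
    {V : ℝ} (hV : 0 ≤ V) (y : Space n) {ε : ℝ} (hε : 0 < ε) :
    Integrable (Function.uncurry fun x s ↦ u x * frozenDeriv l hl V y s x)
      (volume.prod (volume.restrict (Set.Ioc ε 1))) := by
  obtain ⟨A, hA0, hA⟩ := exists_schwartz_bound (kernel n l hl) (n + 1)
  obtain ⟨B, hB0, hB⟩ := exists_schwartz_bound (negLap l (kernel n l hl)) (n + 1)
  have h1 := integrable_mul_bump hu one_pos y
  have h2 : Integrable (fun _ : ℝ ↦ 2 * l * (V * A + ε⁻¹ * B) * (ε ^ n)⁻¹)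
      (volume.restrict (Set.Ioc ε 1)) := integrable_const _
  have hm : AEStronglyMeasurable (Function.uncurry fun x s ↦ u x * frozenDeriv l hl V y s x)
      (volume.prod (volume.restrict (Set.Ioc ε 1))) := by
    refine hu.1.comp_fst.mul ?_
    exact ((measurable_frozenDeriv hl V y).comp measurable_swap).aestronglyMeasurable
  refine (h1.mul_prod h2).mono' hm ?_
  have hs : ∀ᵐ p : Space n × ℝ ∂(volume.prod (volume.restrict (Set.Ioc ε 1))),
      p.2 ∈ Set.Ioc ε 1 :=
    Measure.quasiMeasurePreserving_snd.ae (ae_restrict_mem measurableSet_Ioc)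
  filter_upwards [hs] with p hp
  obtain ⟨x, s⟩ := p
  have hs0 : 0 < s := hε.trans hp.1
  have hbump : bump (n + 1) s (x - y) ≤ (ε ^ n)⁻¹ * bump (n + 1) 1 (x - y) := by
    unfold bump
    have : 1 ≤ s⁻¹ := (one_le_inv₀ hs0).2 hp.2
    have := hp.1.le
    simp only [one_pow, inv_one, one_mul]
    gcongr
    exact le_mul_of_one_le_left (norm_nonneg _) (by assumption)
  have hE1 : Real.exp (-(s ^ (2 * l) * V)) ≤ 1 :=
    Real.exp_le_one_iff.2 (neg_nonpos.2 (by positivity))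
  have n1 := norm_dilated_le hA hs0 y x
  have n2 := norm_dilated_le hB hs0 y x
  have hb0 := bump_nonneg (a := n + 1) hs0 (x - y)
  have hb1 := bump_nonneg (a := n + 1) one_pos (x - y)
  have hp1 : s ^ (2 * l - 1) ≤ 1 := pow_le_one₀ hs0.le hp.2
  have hsε : s⁻¹ ≤ ε⁻¹ := by have := hp.1.le; gcongr
  change ‖u x * frozenDeriv l hl V y s x‖ ≤ _
  rw [norm_mul, frozenDeriv, norm_mul, Complex.norm_real, norm_neg,
    Real.norm_of_nonneg (by positivity)]
  have n3 : ‖((s ^ (2 * l - 1) * V : ℝ) : ℂ) * dilated (kernel n l hl) s y x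
      + ((s⁻¹ : ℝ) : ℂ) * dilated (negLap l (kernel n l hl)) s y x‖
      ≤ (1 * V) * (A * bump (n + 1) s (x - y)) + ε⁻¹ * (B * bump (n + 1) s (x - y)) := by
    refine (norm_add_le _ _).trans ?_
    rw [norm_mul, norm_mul, Complex.norm_real, Complex.norm_real,
      Real.norm_of_nonneg (by positivity), Real.norm_of_nonneg (by positivity)]
    gcongr
  calc _ ≤ ‖u x‖ * (2 * l * 1 *
        ((1 * V) * (A * bump (n + 1) s (x - y)) + ε⁻¹ * (B * bump (n + 1) s (x - y)))) := by
        gcongr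
    _ = ‖u x‖ * (2 * l * (V * A + ε⁻¹ * B)) * bump (n + 1) s (x - y) := by ring
    _ ≤ ‖u x‖ * (2 * l * (V * A + ε⁻¹ * B)) * ((ε ^ n)⁻¹ * bump (n + 1) 1 (x - y)) := by gcongr
    _ = _ := by ring

/-- The average of `|u|` against the fast decaying bump of width `s` around `y`. -/
noncomputable def fastAverage {n : ℕ} (u : Space n → ℂ) (s : ℝ) (y : Space n) : ℝ≥0∞ :=
  ∫⁻ x, ‖u x‖ₑ * ENNReal.ofReal (bump (2 * (n + 1)) s (x - y))

theorem fastAverage_le_average {n : ℕ} (u : Space n → ℂ) {s : ℝ} (hs : 0 < s) (y : Space n) :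
    fastAverage u s y ≤ average u s y := by
  unfold fastAverage average
  gcongr
  exact bump_two_mul_le hs _

theorem enorm_integral_mul_le {n : ℕ} {u F : Space n → ℂ} {b : Space n → ℝ} {C : ℝ} (hC : 0 ≤ C)
    (h : ∀ x, ‖F x‖ ≤ C * b x) :
    ‖∫ x, u x * F x‖ₑ ≤ ENNReal.ofReal C * ∫⁻ x, ‖u x‖ₑ * ENNReal.ofReal (b x) := by
  refine (enorm_integral_le_lintegral_enorm _).trans ?_
  rw [← lintegral_const_mul' _ _ ENNReal.ofReal_ne_top]
  refine lintegral_mono fun x ↦ ?_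
  rw [enorm_mul, mul_left_comm, ← ENNReal.ofReal_mul hC, ← ofReal_norm (F x)]
  gcongr
  exact h x

/-- The fundamental theorem of calculus in s compares width ε with width 1, where the L² norm
suffices. The constant depends on neither ε nor y. -/
theorem IsWeakSolution.exists_mollified_bound {n k l : ℕ} (hl : 1 ≤ l) {u : Space n → ℂ}
    (hu : MemLp u 2) {c : ℂ} (h : IsWeakSolution k l u c) :
    ∃ C : ℝ≥0∞, C ≠ ∞ ∧ ∀ ε : ℝ, 0 < ε → ε ≤ 1 → ∀ y : Space n,
      ENNReal.ofReal (Real.exp (-(ε ^ (2 * l) * ‖y‖ ^ (2 * k)))) *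
        ‖∫ x, u x * dilated (kernel n l hl) ε y x‖ₑ
      ≤ C + C * ∫⁻ s in Set.Ioc (0 : ℝ) 1, fastAverage u s y := by
  obtain ⟨A, hA0, hA⟩ := exists_schwartz_bound (kernel n l hl) (n + 1)
  obtain ⟨B, hB0, hB⟩ := exists_error_kernel_bound n k l hl c
  set N := bumpMass n + ENNReal.ofReal (((1 : ℝ) ^ n)⁻¹) * ∫⁻ x, ‖u x‖ₑ ^ 2 with hN
  have hN' : N ≠ ∞ := ENNReal.add_ne_top.2
    ⟨bumpMass_ne_top n, ENNReal.mul_ne_top ENNReal.ofReal_ne_top (lintegral_sq_lt_top hu).ne⟩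
  refine ⟨ENNReal.ofReal A * N + ENNReal.ofReal B, by finiteness, fun ε hε hε1 y ↦ ?_⟩
  set V := ‖y‖ ^ (2 * k) with hV
  have hV0 : 0 ≤ V := by positivity
  have hfr : ∀ s, 0 < s → Integrable fun x ↦ u x * frozen l hl V y s x := fun s hs ↦ by
    refine ((integrable_mul_dilated hu (kernel n l hl) hs y).const_mul
      ((Real.exp (-(s ^ (2 * l) * V)) : ℝ) : ℂ)).congr (ae_of_all _ fun x ↦ ?_)
    simp only [frozen]; ring
  have key : ∫ x, u x * frozen l hl V y ε x = (∫ x, u x * frozen l hl V y 1 x)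
      - ∫ s in Set.Ioc ε 1, ∫ x, u x * frozenDeriv l hl V y s x := by
    rw [← integral_integral_swap (integrable_uncurry_frozenDeriv hl hu hV0 y hε)]
    have : ∀ x, ∫ s in Set.Ioc ε 1, u x * frozenDeriv l hl V y s x
        = u x * frozen l hl V y 1 x - u x * frozen l hl V y ε x := fun x ↦ by
      rw [integral_const_mul, ← frozen_sub_frozen hl V y hε hε1, mul_sub]
    simp_rw [this]
    rw [integral_sub (hfr 1 one_pos) (hfr ε hε)]
    ring
  have e1 : ENNReal.ofReal (Real.exp (-(ε ^ (2 * l) * V))) *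
        ‖∫ x, u x * dilated (kernel n l hl) ε y x‖ₑ = ‖∫ x, u x * frozen l hl V y ε x‖ₑ := by
    have : ∀ x, u x * frozen l hl V y ε x = (Real.exp (-(ε ^ (2 * l) * V)) : ℝ) *
        (u x * dilated (kernel n l hl) ε y x) := fun x ↦ by simp only [frozen]; ring
    simp_rw [this]
    rw [integral_const_mul, enorm_mul, ← ofReal_norm ((_ : ℝ) : ℂ), Complex.norm_real,
      Real.norm_of_nonneg (Real.exp_pos _).le]
  have e2 : ‖∫ x, u x * frozen l hl V y 1 x‖ₑ ≤ ENNReal.ofReal A * N := by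
    refine (enorm_integral_mul_le hA0 (b := fun x ↦ bump (n + 1) 1 (x - y)) fun x ↦ ?_).trans
      (by gcongr; exact average_le hu one_pos y)
    rw [frozen, norm_mul, Complex.norm_real, Real.norm_of_nonneg (Real.exp_pos _).le]
    refine (mul_le_of_le_one_left (norm_nonneg _) (Real.exp_le_one_iff.2 ?_)).trans
      (norm_dilated_le hA one_pos y x)
    simpa using hV0
  have e3 : ‖∫ s in Set.Ioc ε 1, ∫ x, u x * frozenDeriv l hl V y s x‖ₑ
      ≤ ENNReal.ofReal B * ∫⁻ s in Set.Ioc (0 : ℝ) 1, fastAverage u s y := by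
    refine (enorm_integral_le_lintegral_enorm _).trans ?_
    rw [← lintegral_const_mul' _ _ ENNReal.ofReal_ne_top]
    refine (setLIntegral_mono_ae' measurableSet_Ioc (ae_of_all _ fun s hs ↦ ?_)).trans
      (lintegral_mono_set (Set.Ioc_subset_Ioc_left hε.le))
    have hs0 : 0 < s := hε.trans hs.1
    rw [h.integral_frozenDeriv hl hu V y hs0]
    exact enorm_integral_mul_le hB0 fun x ↦ hB s hs0 hs.2 x y
  rw [e1, key]
  refine (enorm_sub_le).trans ((add_le_add e2 e3).trans ?_)
  gcongr
  · exact le_self_add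
  · exact le_add_self

/-! ### Passage to the limit of vanishing width -/

theorem tendsto_eLpNorm_translate_sub {n : ℕ} {u : Space n → ℂ} (hu : MemLp u 2) :
    Tendsto (fun h : Space n ↦ eLpNorm (fun y ↦ u (h + y) - u y) 2 volume) (𝓝 0) (𝓝 0) := by
  have : Fact ((2 : ℝ≥0∞) ≠ ∞) := ⟨by simp⟩
  have hc : Continuous fun h : Space n ↦ DomAddAct.mk h +ᵥ hu.toLp u :=
    (DomAddAct.mkHomeomorph.continuous).vadd continuous_const
  have ht := hc.tendsto 0
  have h0 : DomAddAct.mk (0 : Space n) +ᵥ hu.toLp u = hu.toLp u := zero_vadd _ _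
  rw [h0] at ht
  have hmem : ∀ h : Space n, MemLp (fun y ↦ u (h + y)) 2 := fun h ↦
    hu.comp_measurePreserving (measurePreserving_add_left volume h)
  have e : ∀ h : Space n, DomAddAct.mk h +ᵥ hu.toLp u = (hmem h).toLp _ := fun h ↦
    DomAddAct.mk_vadd_toLp h hu
  simp_rw [e] at ht
  exact (Lp.tendsto_Lp_iff_tendsto_eLpNorm'' (fun (h : Space n) y ↦ u (h + y)) hmem u hu).1 ht

theorem lintegral_mul_translate_sub_le {n : ℕ} {u : Space n → ℂ} (hum : Measurable u)
    (φ : 𝓢(Space n, ℂ)) (h : Space n) : ∫⁻ y, ‖φ y‖ₑ * ‖u (h + y) - u y‖ₑ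
      ≤ eLpNorm φ 2 volume * eLpNorm (fun y ↦ u (h + y) - u y) 2 volume := by
  have hm : AEStronglyMeasurable (fun y ↦ u (h + y) - u y) volume :=
    (show Measurable fun y ↦ u (h + y) - u y by fun_prop).aestronglyMeasurable
  have := eLpNorm_smul_le_mul_eLpNorm (p := 2) (q := 2) (r := 1) hm
    φ.continuous.aestronglyMeasurable
  rw [eLpNorm_one_eq_lintegral_enorm] at this
  simpa [enorm_mul] using this

theorem eLpNorm_translate_sub_le {n : ℕ} {u : Space n → ℂ} (hu : MemLp u 2) (h : Space n) :
    eLpNorm (fun y ↦ u (h + y) - u y) 2 volume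
      ≤ eLpNorm u 2 volume + eLpNorm u 2 volume := by
  have hmp := measurePreserving_add_left (volume : Measure (Space n)) h
  have h1 := eLpNorm_comp_measurePreserving (p := 2) hu.1 hmp
  refine (eLpNorm_sub_le (hu.1.comp_measurePreserving hmp) hu.1 (by norm_num)).trans ?_
  exact add_le_add_left h1.le _

theorem tendsto_lintegral_translate_sub {n : ℕ} {u : Space n → ℂ} (hu : MemLp u 2)
    (hum : Measurable u) (f φ : 𝓢(Space n, ℂ)) {ε : ℕ → ℝ} (hε : Tendsto ε atTop (𝓝 0)) :
    Tendsto (fun m ↦ ∫⁻ w, ‖f w‖ₑ * ∫⁻ y, ‖φ y‖ₑ * ‖u (ε m • w + y) - u y‖ₑ) atTop (𝓝 0) := by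
  have hfm := f.continuous.measurable
  have hφm := φ.continuous.measurable
  have hφmem : MemLp φ 2 volume := φ.memLp 2
  have hφ2 : eLpNorm φ 2 volume ≠ ∞ := hφmem.2.ne
  have hfin : ∫⁻ w, ‖f w‖ₑ ≠ ∞ := f.integrable.2.ne
  have hlim := tendsto_lintegral_of_dominated_convergence (μ := (volume : Measure (Space n)))
      (F := fun m w ↦ ‖f w‖ₑ * ∫⁻ y, ‖φ y‖ₑ * ‖u (ε m • w + y) - u y‖ₑ) (f := fun _ ↦ 0)
      (fun w ↦ ‖f w‖ₑ * (eLpNorm φ 2 volume * (eLpNorm u 2 volume + eLpNorm u 2 volume)))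
      ?_ (fun m ↦ ae_of_all _ fun w ↦ ?_) ?_ (ae_of_all _ fun w ↦ ?_)
  · simpa using hlim
  · intro m
    exact hfm.enorm.mul (Measurable.lintegral_prod_right' (f := fun p : Space n × Space n ↦
      ‖φ p.2‖ₑ * ‖u (ε m • p.1 + p.2) - u p.2‖ₑ) (by fun_prop))
  · change ‖f w‖ₑ * _ ≤ ‖f w‖ₑ * _
    gcongr
    exact (lintegral_mul_translate_sub_le hum φ _).trans
      (by gcongr; exact eLpNorm_translate_sub_le hu _)
  · have := hu.2.ne
    rw [lintegral_mul_const _ hfm.enorm]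
    finiteness
  · have h1 : Tendsto (fun m ↦ ε m • w) atTop (𝓝 0) := by
      simpa using hε.smul_const w
    have h2 := (tendsto_eLpNorm_translate_sub hu).comp h1
    have h3 : Tendsto (fun m ↦ ‖f w‖ₑ * (eLpNorm φ 2 volume *
        eLpNorm (fun y ↦ u (ε m • w + y) - u y) 2 volume)) atTop (𝓝 0) := by
      have := ENNReal.Tendsto.const_mul (a := ‖f w‖ₑ)
        (ENNReal.Tendsto.const_mul (a := eLpNorm φ 2 volume) h2 (Or.inr hφ2)) (Or.inr (by simp))
      simpa using this
    refine tendsto_of_tendsto_of_tendsto_of_le_of_le tendsto_const_nhds h3 (fun _ ↦ zero_le)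
      fun m ↦ ?_
    gcongr
    exact lintegral_mul_translate_sub_le hum φ _

theorem lintegral_oscillation_swap {n : ℕ} {u : Space n → ℂ} (hum : Measurable u)
    (f φ : 𝓢(Space n, ℂ)) (s : ℝ) :
    ∫⁻ y, ‖φ y‖ₑ * ∫⁻ w, ‖u (s • w + y) - u y‖ₑ * ‖f w‖ₑ
      = ∫⁻ w, ‖f w‖ₑ * ∫⁻ y, ‖φ y‖ₑ * ‖u (s • w + y) - u y‖ₑ := by
  have hfm := f.continuous.measurable
  have hφm := φ.continuous.measurable
  have h1 : ∀ y, ‖φ y‖ₑ * ∫⁻ w, ‖u (s • w + y) - u y‖ₑ * ‖f w‖ₑ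
      = ∫⁻ w, ‖φ y‖ₑ * (‖u (s • w + y) - u y‖ₑ * ‖f w‖ₑ) := fun y ↦
    (lintegral_const_mul' _ _ enorm_ne_top).symm
  have h2 : ∀ w, ‖f w‖ₑ * ∫⁻ y, ‖φ y‖ₑ * ‖u (s • w + y) - u y‖ₑ
      = ∫⁻ y, ‖f w‖ₑ * (‖φ y‖ₑ * ‖u (s • w + y) - u y‖ₑ) := fun w ↦
    (lintegral_const_mul' _ _ enorm_ne_top).symm
  rw [lintegral_congr h1, lintegral_congr h2,
    lintegral_lintegral_swap (Measurable.aemeasurable (by fun_prop))]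
  refine lintegral_congr fun w ↦ lintegral_congr fun y ↦ ?_
  ring

/-- Continuity of translations in L², integrated against a nowhere vanishing Schwartz weight φ,
gives convergence to 0 in mean. Fatou's lemma then makes the liminf vanish almost everywhere, and
smallness for infinitely many m is enough later. -/
theorem ae_frequently_oscillation_lt {n : ℕ} {u : Space n → ℂ} (hu : MemLp u 2)
    (hum : Measurable u) (f : 𝓢(Space n, ℂ)) {ε : ℕ → ℝ} (hε : Tendsto ε atTop (𝓝 0)) :
    ∀ᵐ y : Space n, ∀ δ : ℝ≥0∞, 0 < δ →
      ∃ᶠ m in atTop, ∫⁻ w, ‖u (ε m • w + y) - u y‖ₑ * ‖f w‖ₑ < δ := by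
  obtain ⟨φ, hφ0⟩ : ∃ φ : 𝓢(Space n, ℂ), ∀ y, ‖φ y‖ₑ ≠ 0 := by
    refine ⟨expSymb n 1 le_rfl, fun y ↦ ?_⟩
    rw [expSymb_apply, enorm_ne_zero]
    exact Complex.ofReal_ne_zero.2 (Real.exp_pos _).ne'
  have hfm := f.continuous.measurable
  have hφm := φ.continuous.measurable
  have hDm : ∀ m, Measurable fun y ↦ ‖φ y‖ₑ * ∫⁻ w, ‖u (ε m • w + y) - u y‖ₑ * ‖f w‖ₑ := fun m ↦
    hφm.enorm.mul (Measurable.lintegral_prod_right' (f := fun p : Space n × Space n ↦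
      ‖u (ε m • p.2 + p.1) - u p.1‖ₑ * ‖f p.2‖ₑ) (by fun_prop))
  have hlim := tendsto_lintegral_translate_sub hu hum f φ hε
  simp_rw [← lintegral_oscillation_swap hum f φ] at hlim
  have hzero : ∫⁻ y, liminf (fun m ↦ ‖φ y‖ₑ * ∫⁻ w, ‖u (ε m • w + y) - u y‖ₑ * ‖f w‖ₑ) atTop
      = 0 :=
    le_antisymm ((lintegral_liminf_le hDm).trans hlim.liminf_eq.le) zero_le
  rw [lintegral_eq_zero_iff (Measurable.liminf hDm)] at hzero
  filter_upwards [hzero] with y hy δ hδ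
  have h1 : liminf (fun m ↦ ‖φ y‖ₑ * ∫⁻ w, ‖u (ε m • w + y) - u y‖ₑ * ‖f w‖ₑ) atTop
      < ‖φ y‖ₑ * δ := by
    rw [hy]
    exact ENNReal.mul_pos (hφ0 y) hδ.ne'
  refine (frequently_lt_of_liminf_lt (by isBoundedDefault) h1).mono fun m hm ↦ ?_
  exact lt_of_mul_lt_mul_left' hm

theorem integral_mul_dilated_eq {n : ℕ} (u : Space n → ℂ) (f : 𝓢(Space n, ℂ)) {s : ℝ} (hs : 0 < s)
    (y : Space n) : ∫ x, u x * dilated f s y x = ∫ w, u (s • w + y) * f w := by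
  have h1 := Measure.integral_comp_smul (volume : Measure (Space n))
    (fun x ↦ u (x + y) * dilated f s y (x + y)) s
  rw [integral_add_right_eq_self (fun x ↦ u x * dilated f s y x) y, finrank_euclideanSpace_fin,
    abs_of_pos (by positivity)] at h1
  have h2 : (s ^ n) • ∫ x, u (s • x + y) * dilated f s y (s • x + y)
      = ∫ x, u x * dilated f s y x := by
    rw [h1, smul_smul, mul_inv_cancel₀ (by positivity), one_smul]
  rw [← h2, Complex.real_smul, ← integral_const_mul]
  refine integral_congr_ae (ae_of_all _ fun w ↦ ?_)
  have hs' : (s : ℂ) ≠ 0 := by exact_mod_cast hs.ne'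
  simp only [dilated, add_sub_cancel_right, inv_smul_smul₀ hs.ne']
  push_cast
  field_simp

theorem enorm_le_enorm_mollified_add {n : ℕ} {u : Space n → ℂ} (hu : MemLp u 2)
    {f : 𝓢(Space n, ℂ)} (hf : ∫ w, f w = 1) {s : ℝ} (hs : 0 < s) (y : Space n) :
    ‖u y‖ₑ ≤ ‖∫ x, u x * dilated f s y x‖ₑ + ∫⁻ w, ‖u (s • w + y) - u y‖ₑ * ‖f w‖ₑ := by
  have hmem : MemLp (fun w ↦ u (s • w + y)) 2 := by
    have h1 : MemLp (fun x ↦ u (x + y)) 2 :=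
      hu.comp_measurePreserving (measurePreserving_add_right volume y)
    have h2 : Integrable fun w ↦ ‖u (s • w + y)‖ ^ 2 :=
      (h1.integrable_norm_pow (by norm_num)).comp_smul hs.ne'
    have hm : AEStronglyMeasurable (fun w ↦ u (s • w + y)) volume :=
      h1.1.comp_quasiMeasurePreserving
        ⟨measurable_const_smul s, Measure.quasiMeasurePreserving_smul volume hs.ne' |>.2⟩
    exact (memLp_two_iff_integrable_sq_norm hm).2 h2
  have e : u y = (∫ x, u x * dilated f s y x) - ∫ w, (u (s • w + y) - u y) * f w := by
    rw [integral_mul_dilated_eq u f hs, ← integral_sub (integrable_mul_schwartz hmem f)]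
    · have : ∀ w, u (s • w + y) * f w - (u (s • w + y) - u y) * f w = u y * f w := fun w ↦ by ring
      simp_rw [this]
      rw [integral_const_mul, hf, mul_one]
    · simp_rw [sub_mul]
      exact (integrable_mul_schwartz hmem f).sub (f.integrable.const_mul _)
  calc ‖u y‖ₑ = ‖(∫ x, u x * dilated f s y x) - ∫ w, (u (s • w + y) - u y) * f w‖ₑ := by rw [← e]
    _ ≤ ‖∫ x, u x * dilated f s y x‖ₑ + ‖∫ w, (u (s • w + y) - u y) * f w‖ₑ := enorm_sub_le
    _ ≤ _ := by
        gcongr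
        refine (enorm_integral_le_lintegral_enorm _).trans_eq ?_
        simp_rw [enorm_mul]

theorem IsWeakSolution.exists_ae_bound {n k l : ℕ} (hl : 1 ≤ l) {u : Space n → ℂ}
    (hu : MemLp u 2) (hum : Measurable u) {c : ℂ} (h : IsWeakSolution k l u c) :
    ∃ C : ℝ≥0∞, C ≠ ∞ ∧ ∀ᵐ y : Space n,
      ‖u y‖ₑ ≤ C + C * ∫⁻ s in Set.Ioc (0 : ℝ) 1, fastAverage u s y := by
  obtain ⟨C, hC, hb⟩ := h.exists_mollified_bound hl hu
  refine ⟨C, hC, ?_⟩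
  have hε : Tendsto (fun m : ℕ ↦ 1 / ((m : ℝ) + 1)) atTop (𝓝 0) :=
    tendsto_one_div_add_atTop_nhds_zero_nat
  filter_upwards [ae_frequently_oscillation_lt hu hum (kernel n l hl) hε] with y hy
  refine ENNReal.le_of_forall_pos_le_add fun δ hδ _ ↦ ?_
  have hlim : Tendsto (fun m : ℕ ↦ ENNReal.ofReal (Real.exp
      (-((1 / ((m : ℝ) + 1)) ^ (2 * l) * ‖y‖ ^ (2 * k)))) * ‖u y‖ₑ) atTop (𝓝 ‖u y‖ₑ) := by
    have h1 : Continuous fun t : ℝ ↦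
        ENNReal.ofReal (Real.exp (-(t ^ (2 * l) * ‖y‖ ^ (2 * k)))) :=
      ENNReal.continuous_ofReal.comp (by fun_prop)
    have h2 := (h1.tendsto 0).comp hε
    have h3 := ENNReal.Tendsto.mul_const (b := ‖u y‖ₑ) h2 (Or.inr enorm_ne_top)
    have hl0 : l ≠ 0 := by omega
    simpa [hl0] using h3
  refine le_of_tendsto_of_frequently hlim ((hy δ (by exact_mod_cast hδ)).mono fun m hm ↦ ?_)
  have hm0 : 0 < 1 / ((m : ℝ) + 1) := by positivity
  have hm1 : 1 / ((m : ℝ) + 1) ≤ 1 := by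
    rw [div_le_one (by positivity)]
    linarith [(Nat.cast_nonneg m : (0 : ℝ) ≤ m)]
  have e1 := enorm_le_enorm_mollified_add hu (integral_kernel (n := n) hl) hm0 y
  have e2 := hb _ hm0 hm1 y
  have e3 : ENNReal.ofReal (Real.exp (-((1 / ((m : ℝ) + 1)) ^ (2 * l) * ‖y‖ ^ (2 * k)))) ≤ 1 := by
    rw [ENNReal.ofReal_le_one, Real.exp_le_one_iff, neg_nonpos]
    positivity
  calc _ ≤ ENNReal.ofReal (Real.exp (-((1 / ((m : ℝ) + 1)) ^ (2 * l) * ‖y‖ ^ (2 * k)))) *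
        (‖∫ x, u x * dilated (kernel n l hl) (1 / ((m : ℝ) + 1)) y x‖ₑ + δ) := by
        gcongr
        exact e1.trans (by gcongr)
    _ ≤ _ := by
        rw [mul_add]
        gcongr
        exact mul_le_of_le_one_left zero_le e3

/-! ### Bootstrap from averages to boundedness -/

theorem measurable_fastAverage {n : ℕ} {u : Space n → ℂ} (hum : Measurable u) :
    Measurable fun p : ℝ × Space n ↦ fastAverage u p.1 p.2 := by
  unfold fastAverage
  refine Measurable.lintegral_prod_right' (f := fun q : (ℝ × Space n) × Space n ↦
    ‖u q.2‖ₑ * ENNReal.ofReal (bump (2 * (n + 1)) q.1.1 (q.2 - q.1.2))) ?_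
  have : Measurable fun q : (ℝ × Space n) × Space n ↦
      bump (2 * (n + 1)) q.1.1 (q.2 - q.1.2) :=
    measurable_bump.comp (f := fun q : (ℝ × Space n) × Space n ↦ (q.1.1, q.2 - q.1.2)) (by fun_prop)
  fun_prop

theorem measurable_ofReal_bump {n a : ℕ} (s : ℝ) (z : Space n) :
    Measurable fun y : Space n ↦ ENNReal.ofReal (bump a s (y - z)) :=
  (measurable_bump.comp (f := fun y : Space n ↦ (s, y - z)) (by fun_prop)).ennreal_ofReal

theorem lintegral_fastAverage_mul_bump_le {n : ℕ} {u : Space n → ℂ} (hum : Measurable u)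
    {s t : ℝ} (hs : 0 < s) (hst : s ≤ t) (z : Space n) :
    ∫⁻ y, fastAverage u s y * ENNReal.ofReal (bump (n + 1) t (y - z))
      ≤ bumpMass n * average u t z := by
  have ht : 0 < t := hs.trans_le hst
  have hb : ∀ a : ℕ, Measurable fun p : Space n × Space n ↦
      ENNReal.ofReal (bump a s (p.2 - p.1)) := fun a ↦
    (measurable_bump.comp (f := fun p : Space n × Space n ↦ (s, p.2 - p.1))
      (by fun_prop)).ennreal_ofReal
  have hb2 : Measurable fun p : Space n × Space n ↦ ENNReal.ofReal (bump (n + 1) t (p.1 - z)) :=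
    (measurable_ofReal_bump t z).comp measurable_fst
  unfold fastAverage
  simp_rw [← lintegral_mul_const' _ _ ENNReal.ofReal_ne_top]
  rw [lintegral_lintegral_swap (Measurable.aemeasurable
    (((hum.comp measurable_snd).enorm.mul (hb _)).mul hb2)), average,
    ← lintegral_const_mul' _ _ (bumpMass_ne_top n)]
  refine lintegral_mono fun x ↦ ?_
  calc ∫⁻ y, ‖u x‖ₑ * ENNReal.ofReal (bump (2 * (n + 1)) s (x - y)) *
        ENNReal.ofReal (bump (n + 1) t (y - z))
      ≤ ∫⁻ y, (‖u x‖ₑ * ENNReal.ofReal (bump (n + 1) t (x - z))) *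
          ENNReal.ofReal (bump (n + 1) s (x - y)) := by
        refine lintegral_mono fun y ↦ ?_
        rw [mul_assoc, mul_assoc, ← ENNReal.ofReal_mul (bump_nonneg hs _),
          ← ENNReal.ofReal_mul (bump_nonneg ht _), mul_comm (bump _ s _)]
        gcongr _ * ENNReal.ofReal ?_
        exact bump_mul_bump_le hs hst x y z
    _ = bumpMass n * (‖u x‖ₑ * ENNReal.ofReal (bump (n + 1) t (x - z))) := by
        rw [lintegral_const_mul' _ _ (by finiteness), lintegral_bump' hs, mul_comm]

/-- Averaging the bound at scale t turns the scale-s term into O(max(s,t)^{-α}). This is at most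
t^{-β} s^{-1/2}, where β = max(α - 1/2, 0), and s^{-1/2} is integrable on (0, 1]. -/
theorem average_bootstrap {n : ℕ} {u : Space n → ℂ} (hum : Measurable u) {C : ℝ≥0∞}
    (hC : C ≠ ∞) (hb : ∀ᵐ y : Space n,
      ‖u y‖ₑ ≤ C + C * ∫⁻ s in Set.Ioc (0 : ℝ) 1, fastAverage u s y)
    {α : ℝ} {K : ℝ≥0∞} (hK : K ≠ ∞)
    (hav : ∀ t : ℝ, 0 < t → t ≤ 1 → ∀ y, average u t y ≤ K * ENNReal.ofReal (t ^ (-α))) :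
    ∃ K' : ℝ≥0∞, K' ≠ ∞ ∧ ∀ t : ℝ, 0 < t → t ≤ 1 → ∀ y,
      average u t y ≤ K' * ENNReal.ofReal (t ^ (-(max (α - 1 / 2) 0))) := by
  set β := max (α - 1 / 2) 0 with hβ
  set J := ∫⁻ s in Set.Ioc (0 : ℝ) 1, ENNReal.ofReal (s ^ (-(1 / 2) : ℝ)) with hJ
  have hJ' : J ≠ ∞ := by
    have h1 : IntervalIntegrable (fun s : ℝ ↦ s ^ (-(1 / 2) : ℝ)) volume 0 1 :=
      intervalIntegral.intervalIntegrable_rpow' (by norm_num)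
    rw [intervalIntegrable_iff_integrableOn_Ioc_of_le zero_le_one] at h1
    exact (hasFiniteIntegral_iff_ofReal (by
      filter_upwards [ae_restrict_mem measurableSet_Ioc] with s hs
      exact Real.rpow_nonneg hs.1.le _) |>.1 h1.2).ne
  have hI := bumpMass_ne_top n
  refine ⟨C * bumpMass n + C * (bumpMass n * K * J), by finiteness, fun t ht ht1 z ↦ ?_⟩
  have h1t : 1 ≤ ENNReal.ofReal (t ^ (-β)) := by
    rw [ENNReal.one_le_ofReal]
    exact Real.one_le_rpow_of_pos_of_le_one_of_nonpos ht ht1 (neg_nonpos.2 (le_max_right _ _))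
  have hmax : ∀ s : ℝ, 0 < s → s ≤ 1 →
      max s t ^ (-α) ≤ t ^ (-β) * s ^ (-(1 / 2) : ℝ) := fun s hs hs1 ↦ by
    have hm0 : 0 < max s t := lt_max_of_lt_left hs
    have hm1 : max s t ≤ 1 := max_le hs1 ht1
    have : -α = -(α - 1 / 2) + -(1 / 2) := by ring
    rw [this, Real.rpow_add hm0]
    refine mul_le_mul ?_ ?_ (by positivity) (by positivity)
    · calc max s t ^ (-(α - 1 / 2)) ≤ max s t ^ (-β) :=
            Real.rpow_le_rpow_of_exponent_ge hm0 hm1 (neg_le_neg (le_max_left _ _))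
        _ ≤ t ^ (-β) := Real.rpow_le_rpow_of_nonpos ht (le_max_right _ _)
            (neg_nonpos.2 (le_max_right _ _))
    · exact Real.rpow_le_rpow_of_nonpos hs (le_max_left _ _) (by norm_num)
  have hinner : ∀ s ∈ Set.Ioc (0 : ℝ) 1,
      ∫⁻ y, fastAverage u s y * ENNReal.ofReal (bump (n + 1) t (y - z))
        ≤ bumpMass n * K * ENNReal.ofReal (t ^ (-β)) * ENNReal.ofReal (s ^ (-(1 / 2) : ℝ)) := by
    intro s hs
    rw [mul_assoc _ (ENNReal.ofReal _), ← ENNReal.ofReal_mul (by positivity)]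
    refine le_trans ?_ (mul_le_mul_right (ENNReal.ofReal_le_ofReal (hmax s hs.1 hs.2)) _)
    -- For s ≤ t the two bumps combine into an average at scale t. For s ≥ t the uniform bound at
    -- scale s is integrated against a bump of fixed mass.
    rcases le_total s t with hst | hst
    · rw [max_eq_right hst, mul_assoc]
      exact (lintegral_fastAverage_mul_bump_le hum hs.1 hst z).trans (by gcongr; exact hav t ht ht1 z)
    · rw [max_eq_left hst]
      calc _ ≤ ∫⁻ y, (K * ENNReal.ofReal (s ^ (-α))) *
            ENNReal.ofReal (bump (n + 1) t (y - z)) := by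
            gcongr with y
            exact (fastAverage_le_average u hs.1 y).trans (hav s hs.1 hs.2 y)
        _ = _ := by
            rw [lintegral_const_mul' _ _ (by finiteness), lintegral_bump ht]
            ring
  have hmeas := measurable_fastAverage hum
  have hmeas' : Measurable fun y : Space n ↦ ∫⁻ s in Set.Ioc (0 : ℝ) 1, fastAverage u s y :=
    Measurable.lintegral_prod_right' (f := fun p : Space n × ℝ ↦ fastAverage u p.2 p.1)
      (hmeas.comp measurable_swap)
  have hbm := measurable_ofReal_bump (n := n) (a := n + 1) t z
  calc average u t z
      ≤ ∫⁻ y, (C + C * ∫⁻ s in Set.Ioc (0 : ℝ) 1, fastAverage u s y) *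
          ENNReal.ofReal (bump (n + 1) t (y - z)) := by
        refine lintegral_mono_ae ?_
        filter_upwards [hb] with y hy
        gcongr
    _ = C * bumpMass n + C * ∫⁻ y, ∫⁻ s in Set.Ioc (0 : ℝ) 1,
          fastAverage u s y * ENNReal.ofReal (bump (n + 1) t (y - z)) := by
        simp_rw [add_mul, mul_assoc C]
        rw [lintegral_add_left (hbm.const_mul C), lintegral_const_mul' _ _ hC,
          lintegral_const_mul' _ _ hC, lintegral_bump ht]
        simp_rw [← lintegral_mul_const' _ _ ENNReal.ofReal_ne_top]
    _ = C * bumpMass n + C * ∫⁻ s in Set.Ioc (0 : ℝ) 1, ∫⁻ y,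
          fastAverage u s y * ENNReal.ofReal (bump (n + 1) t (y - z)) := by
        rw [lintegral_lintegral_swap]
        exact ((hmeas.comp measurable_swap).mul (hbm.comp measurable_fst)).aemeasurable
    _ ≤ C * bumpMass n + C * ∫⁻ s in Set.Ioc (0 : ℝ) 1,
          bumpMass n * K * ENNReal.ofReal (t ^ (-β)) * ENNReal.ofReal (s ^ (-(1 / 2) : ℝ)) := by
        gcongr _ + _ * ?_
        exact setLIntegral_mono_ae' measurableSet_Ioc (ae_of_all _ hinner)
    _ = C * bumpMass n * 1 + C * (bumpMass n * K * J) * ENNReal.ofReal (t ^ (-β)) := by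
        rw [lintegral_const_mul' _ _ (by finiteness)]
        ring
    _ ≤ _ := by
        rw [add_mul]
        gcongr

theorem eLpNorm_top_lt_top_of_ae_bound {n : ℕ} {u : Space n → ℂ} (hu : MemLp u 2)
    (hum : Measurable u) {C : ℝ≥0∞} (hC : C ≠ ∞) (hb : ∀ᵐ y : Space n,
      ‖u y‖ₑ ≤ C + C * ∫⁻ s in Set.Ioc (0 : ℝ) 1, fastAverage u s y) :
    eLpNorm u ∞ volume < ∞ := by
  have hI := bumpMass_ne_top n
  have hind : ∀ m : ℕ, ∃ K : ℝ≥0∞, K ≠ ∞ ∧ ∀ t : ℝ, 0 < t → t ≤ 1 → ∀ y,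
      average u t y ≤ K * ENNReal.ofReal (t ^ (-(max ((n : ℝ) - m / 2) 0))) := by
    intro m
    induction m with
    | zero =>
      have h2 := (lintegral_sq_lt_top hu).ne
      refine ⟨bumpMass n + ∫⁻ x, ‖u x‖ₑ ^ 2, by finiteness, fun t ht ht1 y ↦ ?_⟩
      refine (average_le hu ht y).trans ?_
      have e : t ^ (-(max ((n : ℝ) - (0 : ℕ) / 2) 0)) = (t ^ n)⁻¹ := by
        rw [Nat.cast_zero, zero_div, sub_zero, max_eq_left (Nat.cast_nonneg n),
          Real.rpow_neg ht.le, Real.rpow_natCast]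
      rw [e, add_mul, mul_comm (ENNReal.ofReal _)]
      gcongr
      refine le_mul_of_one_le_right zero_le ?_
      rw [ENNReal.one_le_ofReal]
      exact (one_le_inv₀ (by positivity)).2 (pow_le_one₀ ht.le ht1)
    | succ m ih =>
      obtain ⟨K, hK, hav⟩ := ih
      obtain ⟨K', hK', hav'⟩ := average_bootstrap hum hC hb hK hav
      refine ⟨K', hK', fun t ht ht1 y ↦ ?_⟩
      have e : max ((n : ℝ) - ((m + 1 : ℕ) : ℝ) / 2) 0 = max (max ((n : ℝ) - m / 2) 0 - 1 / 2) 0 := by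
        push_cast
        rcases le_total ((n : ℝ) - m / 2) 0 with h | h
        · rw [max_eq_right h, max_eq_right (by linarith), max_eq_right (by norm_num)]
        · rw [max_eq_left h]
          congr 1
          ring
      rw [e]
      exact hav' t ht ht1 y
  -- The exponent starts at n and drops by 1/2 per round, so it is 0 after 2n rounds.
  obtain ⟨K, hK, hav⟩ := hind (2 * n)
  rw [eLpNorm_exponent_top]
  refine (eLpNormEssSup_le_of_ae_enorm_bound (C := C + C * K) ?_).trans_lt (by finiteness)
  filter_upwards [hb] with y hy
  refine hy.trans ?_
  gcongr
  calc ∫⁻ s in Set.Ioc (0 : ℝ) 1, fastAverage u s y ≤ ∫⁻ _ in Set.Ioc (0 : ℝ) 1, K := by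
        refine setLIntegral_mono_ae' measurableSet_Ioc (ae_of_all _ fun s hs ↦ ?_)
        refine (fastAverage_le_average u hs.1 y).trans ?_
        simpa using hav s hs.1 hs.2 y
    _ = K := by simp

end Anharmonic

/-! ### Interpolation by the three lines theorem -/

namespace Anharmonic

open Filter Topology

/-- The analytic family `a ↦ |a|^{p (1 - z / 2)} sgn a`, interpolating between `|a|^p sgn a` at
`z = 0` and `|a|^{p / 2} sgn a` at `z = 1`. -/
noncomputable def phasePow (p : ℝ) (z a : ℂ) : ℂ := (‖a‖ : ℂ) ^ (p * (1 - z / 2)) * (a / ‖a‖)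

theorem phasePow_zero (p : ℝ) (z : ℂ) : phasePow p z 0 = 0 := by simp [phasePow]

theorem norm_phasePow {p : ℝ} {z : ℂ} (h : 0 < p * (1 - z.re / 2)) (a : ℂ) :
    ‖phasePow p z a‖ = ‖a‖ ^ (p * (1 - z.re / 2)) := by
  rcases eq_or_ne a 0 with rfl | ha
  · rw [phasePow_zero, norm_zero, Real.zero_rpow h.ne']
  · have ha' : 0 < ‖a‖ := norm_pos_iff.2 ha
    rw [phasePow, norm_mul, Complex.norm_cpow_eq_rpow_re_of_pos ha', norm_div, Complex.norm_real,
      norm_norm, div_self ha'.ne', mul_one]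
    congr 1
    simp

theorem phasePow_of_mul_eq_one {p t : ℝ} (h : p * (1 - t / 2) = 1) (a : ℂ) :
    phasePow p t a = a := by
  rcases eq_or_ne a 0 with rfl | ha
  · exact phasePow_zero p t
  · have ha' : (‖a‖ : ℂ) ≠ 0 := by exact_mod_cast (norm_pos_iff.2 ha).ne'
    have : (p : ℂ) * (1 - t / 2) = 1 := by exact_mod_cast h
    rw [phasePow, this, Complex.cpow_one, mul_div_cancel₀ _ ha']

theorem differentiable_phasePow (p : ℝ) (a : ℂ) : Differentiable ℂ fun z ↦ phasePow p z a := by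
  rcases eq_or_ne a 0 with rfl | ha
  · simp only [phasePow_zero]
    exact differentiable_const 0
  · have ha' : (‖a‖ : ℂ) ≠ 0 := by exact_mod_cast (norm_pos_iff.2 ha).ne'
    intro z
    exact (DifferentiableAt.const_cpow (by fun_prop) (Or.inl ha')).mul_const _

theorem norm_phasePow_le {p : ℝ} (hp : 0 < p) {z : ℂ} (h0 : 0 ≤ z.re) (h1 : z.re ≤ 1) (a : ℂ) :
    ‖phasePow p z a‖ ≤ (1 + ‖a‖) ^ p := by
  have h : 0 < p * (1 - z.re / 2) := mul_pos hp (by linarith)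
  rw [norm_phasePow h]
  calc ‖a‖ ^ (p * (1 - z.re / 2)) ≤ (1 + ‖a‖) ^ (p * (1 - z.re / 2)) :=
        Real.rpow_le_rpow (norm_nonneg _) (by linarith) h.le
    _ ≤ (1 + ‖a‖) ^ p :=
        Real.rpow_le_rpow_of_exponent_le (by linarith [norm_nonneg a]) (by nlinarith)

section Interpolation

variable {α ι : Type*} [MeasurableSpace α] {μ : Measure α}

/-- The coefficient `∫ f conj(g)`. -/
noncomputable def coeff (μ : Measure α) (f g : α → ℂ) : ℂ := ∫ x, f x * conj (g x) ∂μ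

theorem memLp_conj {g : α → ℂ} {q : ℝ≥0∞} (hg : MemLp g q μ) : MemLp (fun x ↦ conj (g x)) q μ :=
  hg.star

/-- Displays the coefficient as a finite sum of entire functions of z, so analyticity and
boundedness on the strip are immediate. The level set of 0, possibly of infinite measure, drops out.
-/
theorem coeff_phasePow_simpleFunc {p : ℝ≥0∞} (hp0 : p ≠ 0) (hp : p ≠ ∞) {f : SimpleFunc α ℂ}
    (hf : MemLp f p μ) {g : α → ℂ} (hg : MemLp g 2 μ) (r : ℝ) (z : ℂ) :
    coeff μ (fun x ↦ phasePow r z (f x)) g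
      = ∑ a ∈ f.range, phasePow r z a * ∫ x in f ⁻¹' {a}, conj (g x) ∂μ := by
  have e : ∀ x, phasePow r z (f x) * conj (g x)
      = ∑ a ∈ f.range, phasePow r z a * (f ⁻¹' {a}).indicator (fun x ↦ conj (g x)) x := fun x ↦ by
    rw [Finset.sum_eq_single_of_mem (f x) (f.mem_range_self x)]
    · rw [Set.indicator_of_mem (by simp)]
    · intro a _ ha
      rw [Set.indicator_of_notMem (by simpa using ha.symm), mul_zero]
  unfold coeff
  simp_rw [e]
  rw [integral_finsetSum]
  · refine Finset.sum_congr rfl fun a _ ↦ ?_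
    rw [integral_const_mul, integral_indicator (f.measurableSet_preimage _)]
  · intro a _
    rcases eq_or_ne a 0 with rfl | ha
    · simp only [phasePow_zero, zero_mul]
      exact integrable_zero _ _ _
    · have hfin := SimpleFunc.measure_preimage_lt_top_of_memLp hp0 hp f hf a ha
      have : IsFiniteMeasure (μ.restrict (f ⁻¹' {a})) := ⟨by simpa using hfin⟩
      exact ((integrable_indicator_iff (f.measurableSet_preimage _)).2
        (((memLp_conj hg).restrict _).integrable (by norm_num))).const_mul _

theorem measurable_phasePow_simpleFunc (f : SimpleFunc α ℂ) (r : ℝ) (z : ℂ) :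
    Measurable fun x ↦ phasePow r z (f x) :=
  (f.map (phasePow r z)).measurable

theorem norm_coeff_le_of_bound {f g : α → ℂ} {M : ℝ} (hf : Integrable f μ)
    (hg : ∀ᵐ x ∂μ, ‖g x‖ ≤ M) : ‖coeff μ f g‖ ≤ M * ∫ x, ‖f x‖ ∂μ := by
  refine (norm_integral_le_integral_norm _).trans ?_
  rw [← integral_const_mul]
  refine integral_mono_of_nonneg (ae_of_all _ fun x ↦ norm_nonneg _) (hf.norm.const_mul _) ?_
  filter_upwards [hg] with x hx
  rw [norm_mul, RCLike.norm_conj, mul_comm]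
  gcongr

/-- Both f and a dual sequence B are put into the analytic family, giving Φ. With S the weighted sum
and Q = ∫ |f|^p, the sup bounds give |Φ| ≤ SQ on Re z = 0, while Cauchy–Schwarz and Bessel give
√(SQ) on Re z = 1. At θ = 2/q the family returns f and B themselves and Φ(θ) = S, so S ≤
(SQ)^{1-θ/2} = (SQ)^{1/p}; dividing by S^{1/p} leaves the claim. -/
theorem sum_rpow_coeff_le_simpleFunc {p : ℝ≥0∞} {q : ℝ} (hp1 : 1 < p.toReal) (hp2 : p.toReal ≤ 2)
    (hpq : 1 / p.toReal + 1 / q = 1) {e : ι → α → ℂ} (he : ∀ j, MemLp (e j) 2 μ) {M : ι → ℝ}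
    (hM : ∀ j, 0 < M j) (heM : ∀ j, ∀ᵐ x ∂μ, ‖e j x‖ ≤ M j) {J : Finset ι}
    (hbessel : ∀ g : α → ℂ, MemLp g 2 μ → ∑ j ∈ J, ‖coeff μ g (e j)‖ ^ 2 ≤ ∫ x, ‖g x‖ ^ 2 ∂μ)
    {f : SimpleFunc α ℂ} (hf : MemLp f p μ) :
    (∑ j ∈ J, ‖coeff μ f (e j)‖ ^ q * M j ^ (2 - q)) ^ (1 / q)
      ≤ (∫ x, ‖f x‖ ^ p.toReal ∂μ) ^ (1 / p.toReal) := by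
  have hpt : p ≠ ∞ := fun h ↦ by simp [h] at hp1; linarith
  have hp0 : p ≠ 0 := fun h ↦ by simp [h] at hp1; linarith
  set r := p.toReal with hr
  have hr0 : 0 < r := by linarith
  have hq0 : 0 < q := by
    by_contra h
    have h1 : 1 / q ≤ 0 := by rw [one_div]; exact inv_nonpos.2 (not_lt.1 h)
    have h2 : 1 / r < 1 := by rw [div_lt_one hr0]; exact hp1
    linarith
  have hqr : q + r = r * q := by field_simp at hpq; linarith
  set c : ι → ℂ := fun j ↦ coeff μ f (e j) with hc
  set d : ι → ℝ := fun j ↦ ‖c j‖ / M j with hd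
  have hd0 : ∀ j, 0 ≤ d j := fun j ↦ div_nonneg (norm_nonneg _) (hM j).le
  -- The extremal sequence for duality with c_j / M_j under the weights M_j²; since (q - 1)r = q,
  -- |B_j|^r = d_j^q.
  set B : ι → ℂ := fun j ↦ conj (c j) / ‖c j‖ * ((d j ^ (q - 1) : ℝ) : ℂ) with hB
  set S := ∑ j ∈ J, M j ^ 2 * d j ^ q with hS
  set Q := ∫ x, ‖f x‖ ^ r ∂μ with hQ
  have hS0 : 0 ≤ S := Finset.sum_nonneg fun j _ ↦
    mul_nonneg (sq_nonneg _) (Real.rpow_nonneg (hd0 j) _)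
  have hQ0 : 0 ≤ Q := integral_nonneg fun x ↦ Real.rpow_nonneg (norm_nonneg _) _
  have hq1 : 0 < q - 1 := by nlinarith
  have hBn : ∀ j, ‖B j‖ = d j ^ (q - 1) := fun j ↦ by
    rcases eq_or_ne (c j) 0 with h | h
    · simp [hB, hd, h, Real.zero_rpow hq1.ne']
    · have : ‖c j‖ ≠ 0 := norm_ne_zero_iff.2 h
      simp only [hB]
      rw [norm_mul, norm_div, RCLike.norm_conj, Complex.norm_real, norm_norm, div_self this,
        one_mul, Complex.norm_real, Real.norm_of_nonneg (Real.rpow_nonneg (hd0 j) _)]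
  have hBp : ∀ j, ‖B j‖ ^ r = d j ^ q := fun j ↦ by
    rw [hBn, ← Real.rpow_mul (hd0 j)]
    congr 1
    linarith
  have hBc : ∀ j, (M j : ℂ) * (B j * c j) = ((M j ^ 2 * d j ^ q : ℝ) : ℂ) := fun j ↦ by
    have h1 : conj (c j) * c j = (‖c j‖ : ℂ) * ‖c j‖ := by
      rw [mul_comm, Complex.mul_conj, Complex.normSq_eq_norm_sq]; push_cast; ring
    have h2 : conj (c j) / ‖c j‖ * c j = ‖c j‖ := by
      rcases eq_or_ne (c j) 0 with h | h
      · simp [h]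
      · have : (‖c j‖ : ℂ) ≠ 0 := by exact_mod_cast norm_ne_zero_iff.2 h
        rw [div_mul_eq_mul_div, h1, mul_div_assoc, div_self this, mul_one]
    have h3 : ‖c j‖ = d j * M j := by simp only [hd]; rw [div_mul_cancel₀ _ (hM j).ne']
    have h4 : d j ^ q = d j ^ (q - 1) * d j := by
      have := Real.rpow_add_one' (hd0 j) (y := q - 1) (by linarith)
      rwa [sub_add_cancel] at this
    have h5 : B j * c j = ((‖c j‖ * d j ^ (q - 1) : ℝ) : ℂ) := by
      simp only [hB]
      rw [mul_right_comm, h2]; push_cast; ring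
    rw [h5, h4, h3]
    push_cast
    ring
  set Φ : ℂ → ℂ := fun z ↦ ∑ j ∈ J, (M j : ℂ) *
    (phasePow r z (B j) * coeff μ (fun x ↦ phasePow r z (f x)) (e j)) with hΦ
  have hΦ' : ∀ z, Φ z = ∑ j ∈ J, (M j : ℂ) * (phasePow r z (B j) *
      ∑ a ∈ f.range, phasePow r z a * ∫ x in f ⁻¹' {a}, conj (e j x) ∂μ) := fun z ↦ by
    simp only [hΦ]
    simp_rw [coeff_phasePow_simpleFunc hp0 hpt hf (he _)]
  have hdiff : Differentiable ℂ Φ := by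
    rw [funext hΦ']
    refine Differentiable.fun_sum fun j _ ↦ Differentiable.const_mul
      ((differentiable_phasePow r _).mul (Differentiable.fun_sum fun a _ ↦
        (differentiable_phasePow r a).mul_const _)) _
  have hbdd : BddAbove ((norm ∘ Φ) '' Complex.HadamardThreeLines.verticalClosedStrip 0 1) := by
    refine ⟨∑ j ∈ J, M j * ((1 + ‖B j‖) ^ r *
      ∑ a ∈ f.range, (1 + ‖a‖) ^ r * ‖∫ x in f ⁻¹' {a}, conj (e j x) ∂μ‖), ?_⟩
    rintro _ ⟨z, hz, rfl⟩
    obtain ⟨h0, h1⟩ : 0 ≤ z.re ∧ z.re ≤ 1 := hz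
    simp only [Function.comp_apply, hΦ']
    refine (norm_sum_le _ _).trans (Finset.sum_le_sum fun j _ ↦ ?_)
    rw [norm_mul, norm_mul, Complex.norm_real, Real.norm_of_nonneg (hM j).le]
    have := (hM j).le
    gcongr
    · exact norm_phasePow_le hr0 h0 h1 _
    · refine (norm_sum_le _ _).trans (Finset.sum_le_sum fun a _ ↦ ?_)
      rw [norm_mul]
      gcongr
      exact norm_phasePow_le hr0 h0 h1 _
  have hfQ := hf.integrable_norm_rpow hp0 hpt
  have hleft : ∀ z ∈ Complex.re ⁻¹' {(0 : ℝ)}, ‖Φ z‖ ≤ S * Q := fun z hz ↦ by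
    have hz : z.re = 0 := hz
    have hn : ∀ a, ‖phasePow r z a‖ = ‖a‖ ^ r := fun a ↦ by
      rw [norm_phasePow (by rw [hz]; linarith), hz]; simp
    have hint : Integrable (fun x ↦ phasePow r z (f x)) μ := by
      refine hfQ.mono' (measurable_phasePow_simpleFunc f r z).aestronglyMeasurable
        (ae_of_all _ fun x ↦ (hn _).le)
    rw [hS, Finset.sum_mul]
    refine (norm_sum_le _ _).trans (Finset.sum_le_sum fun j _ ↦ ?_)
    rw [norm_mul, norm_mul, Complex.norm_real, Real.norm_of_nonneg (hM j).le, hn, hBp]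
    have h1 := norm_coeff_le_of_bound hint (heM j)
    simp_rw [hn] at h1
    have := (hM j).le
    have := Real.rpow_nonneg (hd0 j) q
    calc _ ≤ M j * (d j ^ q * (M j * Q)) := by gcongr
      _ = _ := by ring
  have hright : ∀ z ∈ Complex.re ⁻¹' {(1 : ℝ)}, ‖Φ z‖ ≤ √(S * Q) := fun z hz ↦ by
    have hz : z.re = 1 := hz
    have hn : ∀ a, ‖phasePow r z a‖ ^ 2 = ‖a‖ ^ r := fun a ↦ by
      rw [norm_phasePow (by rw [hz]; linarith), hz, ← Real.rpow_natCast,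
        ← Real.rpow_mul (norm_nonneg _)]
      congr 1
      push_cast
      ring
    have hm : MemLp (fun x ↦ phasePow r z (f x)) 2 μ := by
      refine (memLp_two_iff_integrable_sq_norm
        (measurable_phasePow_simpleFunc f r z).aestronglyMeasurable).2 ?_
      simp_rw [hn]
      exact hfQ
    have h1 := hbessel _ hm
    simp_rw [hn] at h1
    have h2 : ‖Φ z‖ ≤ ∑ j ∈ J, (M j * ‖phasePow r z (B j)‖) *
        ‖coeff μ (fun x ↦ phasePow r z (f x)) (e j)‖ := by
      refine (norm_sum_le _ _).trans (Finset.sum_le_sum fun j _ ↦ ?_)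
      rw [norm_mul, norm_mul, Complex.norm_real, Real.norm_of_nonneg (hM j).le, mul_assoc]
    refine h2.trans ((Real.sum_mul_le_sqrt_mul_sqrt _ _ _).trans ?_)
    rw [Real.sqrt_mul hS0]
    simp_rw [mul_pow, hn, hBp]
    gcongr
  set θ : ℝ := 2 / q with hθ
  have hθ' : r * (1 - θ / 2) = 1 := by rw [hθ]; field_simp; linarith
  have hq2 : 2 ≤ q := by nlinarith
  have hθ0 : 0 ≤ θ := by positivity
  have hθ1 : θ ≤ 1 := by rw [hθ, div_le_one hq0]; exact hq2
  have key := Complex.HadamardThreeLines.norm_le_interp_of_mem_verticalClosedStrip₀₁' Φ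
    (z := (θ : ℂ)) ⟨by simpa using hθ0, by simpa using hθ1⟩ hdiff.diffContOnCl hbdd hleft hright
  have hΦθ : Φ θ = (S : ℂ) := by
    simp only [hΦ, phasePow_of_mul_eq_one hθ']
    rw [hS, Complex.ofReal_sum]
    exact Finset.sum_congr rfl fun j _ ↦ hBc j
  rw [hΦθ, Complex.norm_real, Real.norm_of_nonneg hS0, Complex.ofReal_re] at key
  have hSQ : 0 ≤ S * Q := mul_nonneg hS0 hQ0
  have hSeq : ∑ j ∈ J, ‖coeff μ f (e j)‖ ^ q * M j ^ (2 - q) = S := by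
    refine Finset.sum_congr rfl fun j _ ↦ ?_
    simp only [hd, hc]
    rw [Real.div_rpow (norm_nonneg _) (hM j).le, Real.rpow_sub (hM j), Real.rpow_two]
    ring
  rw [hSeq]
  -- The final division by S^{1/r} needs S > 0; for S = 0 the left side is 0.
  rcases hS0.eq_or_lt with h | h
  · rw [← h, Real.zero_rpow (by positivity)]
    exact Real.rpow_nonneg hQ0 _
  have e1 : (S * Q) ^ (1 - θ) * √(S * Q) ^ θ = (S * Q) ^ (1 / r) := by
    rcases hQ0.eq_or_lt with h' | h'
    · rw [← h', mul_zero, Real.sqrt_zero, Real.zero_rpow (by positivity : (1 / r) ≠ 0),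
        Real.zero_rpow (by positivity : θ ≠ 0), mul_zero]
    · rw [Real.sqrt_eq_rpow, ← Real.rpow_mul hSQ, ← Real.rpow_add (mul_pos h h')]
      congr 1
      field_simp
      linarith
  rw [e1, Real.mul_rpow hS0 hQ0] at key
  have e2 : S = S ^ (1 / r) * S ^ (1 / q) := by
    rw [← Real.rpow_add h, hpq, Real.rpow_one]
  nth_rewrite 1 [e2] at key
  exact le_of_mul_le_mul_left key (Real.rpow_pos_of_pos h _)

/-! ### Extension from simple functions to L^p -/

/-- From |g|^q ≤ ‖g‖_∞^{q-2} |g|². It places bounded eigenfunctions in L^{p'}, so that Hölder's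
inequality applies against f. -/
theorem memLp_of_two_le {g : α → ℂ} (h2 : MemLp g 2 μ) (htop : MemLp g ∞ μ) {q : ℝ≥0∞}
    (hq : 2 ≤ q) : MemLp g q μ := by
  rcases eq_or_ne q ∞ with rfl | hqt
  · exact htop
  have hq0 : q ≠ 0 := fun h ↦ by simp [h] at hq
  have hq2 : 2 ≤ q.toReal := by simpa using ENNReal.toReal_mono hqt hq
  refine (integrable_norm_rpow_iff h2.1 hq0 hqt).1 ?_
  have hint : Integrable (fun x ↦ ‖g x‖ ^ 2) μ := h2.integrable_norm_pow (by norm_num)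
  refine (hint.const_mul (lpNorm g ∞ μ ^ (q.toReal - 2))).mono'
    (h2.1.norm.aemeasurable.pow_const _).aestronglyMeasurable ?_
  filter_upwards [ae_le_lpNorm_exponent_top htop] with x hx
  rw [Real.norm_of_nonneg (Real.rpow_nonneg (norm_nonneg _) _)]
  rcases (norm_nonneg (g x)).eq_or_lt with h0 | h0
  · rw [← h0, Real.zero_rpow (by linarith)]
    simp
  · calc ‖g x‖ ^ q.toReal = ‖g x‖ ^ (q.toReal - 2) * ‖g x‖ ^ 2 := by
          rw [← Real.rpow_two, ← Real.rpow_add h0]; congr 1; ring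
      _ ≤ _ := by
          gcongr

theorem integrable_mul_conj {p q : ℝ≥0∞} [p.HolderConjugate q] {f g : α → ℂ} (hf : MemLp f p μ)
    (hg : MemLp g q μ) : Integrable (fun x ↦ f x * conj (g x)) μ :=
  hf.integrable_mul (memLp_conj hg)

theorem enorm_coeff_le {p q : ℝ≥0∞} [p.HolderConjugate q] {f g : α → ℂ} (hf : MemLp f p μ)
    (hg : MemLp g q μ) : ‖coeff μ f g‖ₑ ≤ eLpNorm f p μ * eLpNorm g q μ := by
  have h := eLpNorm_smul_le_mul_eLpNorm (p := p) (q := q) (r := 1) (memLp_conj hg).1 hf.1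
  rw [eLpNorm_one_eq_lintegral_enorm] at h
  have hc : eLpNorm (fun x ↦ conj (g x)) q μ = eLpNorm g q μ :=
    eLpNorm_congr_norm_ae (ae_of_all _ fun x ↦ RCLike.norm_conj _)
  rw [hc] at h
  exact (enorm_integral_le_lintegral_enorm _).trans h

/-- Simple functions are dense in L^p for p < ∞. As J is finite, the left side is continuous in f,
each coefficient being controlled by Hölder with e_j in L^q. -/
theorem sum_rpow_coeff_le {p q : ℝ≥0∞} [hpq : p.HolderConjugate q] (hp1 : 1 < p) (hp2 : p ≤ 2)
    {e : ι → α → ℂ} (he : ∀ j, MemLp (e j) 2 μ) (heq : ∀ j, MemLp (e j) q μ) {M : ι → ℝ}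
    (hM : ∀ j, 0 < M j) (heM : ∀ j, ∀ᵐ x ∂μ, ‖e j x‖ ≤ M j) {J : Finset ι}
    (hbessel : ∀ g : α → ℂ, MemLp g 2 μ → ∑ j ∈ J, ‖coeff μ g (e j)‖ ^ 2 ≤ ∫ x, ‖g x‖ ^ 2 ∂μ)
    {f : α → ℂ} (hf : MemLp f p μ) :
    (∑ j ∈ J, ‖coeff μ f (e j)‖ ^ q.toReal * M j ^ (2 - q.toReal)) ^ (1 / q.toReal)
      ≤ (eLpNorm f p μ).toReal := by
  have hpt : p ≠ ∞ := ne_top_of_le_ne_top (by simp) hp2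
  have hp0 : p ≠ 0 := (zero_lt_one.trans hp1).ne'
  have hr1 : 1 < p.toReal := by
    simpa using (ENNReal.toReal_lt_toReal ENNReal.one_ne_top hpt).2 hp1
  have hr2 : p.toReal ≤ 2 := by simpa using ENNReal.toReal_mono (by simp) hp2
  have hqt : q ≠ ∞ := fun h ↦ by
    have h1 := hpq.inv_add_inv_eq_inv
    rw [h] at h1
    simp only [ENNReal.inv_top, add_zero, inv_one, ENNReal.inv_eq_one] at h1
    exact hp1.ne' h1
  have hq0 : q ≠ 0 := fun h ↦ by
    have h1 := hpq.inv_add_inv_eq_inv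
    rw [h] at h1
    simp at h1
  have hpq' : 1 / p.toReal + 1 / q.toReal = 1 := by
    have h1 := congrArg ENNReal.toReal hpq.inv_add_inv_eq_inv
    rw [ENNReal.toReal_add (by simpa using hp0) (by simpa using hq0)] at h1
    simpa [ENNReal.toReal_inv] using h1
  have hqr0 : 0 < q.toReal := ENNReal.toReal_pos hq0 hqt
  have happ : ∀ m : ℕ, ∃ g : SimpleFunc α ℂ,
      eLpNorm (f - ⇑g) p μ < ((m : ℝ≥0∞) + 1)⁻¹ ∧ MemLp g p μ := fun m ↦
    hf.exists_simpleFunc_eLpNorm_sub_lt hpt (by simp)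
  choose g hg hgm using happ
  have hε : Tendsto (fun m : ℕ ↦ ((m : ℝ≥0∞) + 1)⁻¹) atTop (𝓝 0) := by
    have := (tendsto_add_atTop_iff_nat 1).2 ENNReal.tendsto_inv_nat_nhds_zero
    simpa using this
  have hlim : Tendsto (fun m ↦ eLpNorm (f - ⇑(g m)) p μ) atTop (𝓝 0) :=
    tendsto_of_tendsto_of_tendsto_of_le_of_le tendsto_const_nhds hε (fun _ ↦ zero_le)
      fun m ↦ (hg m).le
  have hcoeff : ∀ j, Tendsto (fun m ↦ coeff μ (g m) (e j)) atTop (𝓝 (coeff μ f (e j))) := by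
    intro j
    rw [tendsto_iff_edist_tendsto_0]
    have h1 := ENNReal.Tendsto.mul_const (b := eLpNorm (e j) q μ) hlim (Or.inr (heq j).eLpNorm_ne_top)
    rw [zero_mul] at h1
    refine tendsto_of_tendsto_of_tendsto_of_le_of_le tendsto_const_nhds h1 (fun _ ↦ zero_le)
      fun m ↦ ?_
    have h2 : coeff μ f (e j) - coeff μ (g m) (e j) = coeff μ (f - ⇑(g m)) (e j) := by
      unfold coeff
      rw [← integral_sub (integrable_mul_conj hf (heq j)) (integrable_mul_conj (hgm m) (heq j))]
      simp_rw [← sub_mul]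
      rfl
    rw [edist_comm, edist_eq_enorm_sub, h2]
    exact enorm_coeff_le (hf.sub (hgm m)) (heq j)
  have hleft : Tendsto (fun m ↦ (∑ j ∈ J, ‖coeff μ (g m) (e j)‖ ^ q.toReal *
      M j ^ (2 - q.toReal)) ^ (1 / q.toReal)) atTop
      (𝓝 ((∑ j ∈ J, ‖coeff μ f (e j)‖ ^ q.toReal * M j ^ (2 - q.toReal)) ^ (1 / q.toReal))) := by
    refine Tendsto.rpow_const (tendsto_finsetSum _ fun j _ ↦ ?_) (Or.inr (by positivity))
    exact ((hcoeff j).norm.rpow_const (Or.inr hqr0.le)).mul_const _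
  have hright : Tendsto (fun m ↦ (eLpNorm f p μ).toReal + (eLpNorm (f - ⇑(g m)) p μ).toReal) atTop
      (𝓝 (eLpNorm f p μ).toReal) := by
    have h1 := (ENNReal.tendsto_toReal ENNReal.zero_ne_top).comp hlim
    simpa using h1.const_add (eLpNorm f p μ).toReal
  refine le_of_tendsto_of_tendsto' hleft hright fun m ↦ ?_
  refine (sum_rpow_coeff_le_simpleFunc hr1 hr2 hpq' he hM heM hbessel (hgm m)).trans ?_
  have h1 : (eLpNorm (g m) p μ).toReal = (∫ x, ‖g m x‖ ^ p.toReal ∂μ) ^ (1 / p.toReal) := by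
    rw [(hgm m).eLpNorm_eq_integral_rpow_norm hp0 hpt, ENNReal.toReal_ofReal (by positivity),
      one_div]
  rw [← h1, ← ENNReal.toReal_add hf.eLpNorm_ne_top (hf.sub (hgm m)).eLpNorm_ne_top]
  refine ENNReal.toReal_mono (ENNReal.add_ne_top.2 ⟨hf.eLpNorm_ne_top, (hf.sub (hgm m)).eLpNorm_ne_top⟩) ?_
  have h2 : (g m : α → ℂ) = f - (f - ⇑(g m)) := by simp
  calc eLpNorm (g m) p μ = eLpNorm (f - (f - ⇑(g m))) p μ := by rw [← h2]
    _ ≤ _ := eLpNorm_sub_le hf.1 (hf.sub (hgm m)).1 hp1.le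

end Interpolation

/-! ### Application to the eigenfunctions -/

theorem IsEigenfunction.supNorm_lt_top {n k l : ℕ} (hl : 1 ≤ l) {v : L2 n} {μ : ℂ}
    (h : IsEigenfunction k l v μ) : supNorm v < ∞ := by
  have hv := Lp.memLp v
  have hvm : Measurable v := (Lp.stronglyMeasurable v).measurable
  obtain ⟨C, hC, hb⟩ := h.isWeakSolution.exists_ae_bound hl hv hvm
  exact eLpNorm_top_lt_top_of_ae_bound hv hvm hC hb

theorem supNorm_ne_zero {n : ℕ} {v : L2 n} (hv : v ≠ 0) : supNorm v ≠ 0 := by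
  rw [supNorm, Ne, eLpNorm_eq_zero_iff (Lp.aestronglyMeasurable v) (by simp)]
  exact fun h ↦ hv ((Lp.eq_zero_iff_ae_eq_zero).2 h)

theorem sum_sq_coeff_le {n : ℕ} {u : ℕ → L2 n} (hu : Orthonormal ℂ u) (J : Finset ℕ)
    {g : Space n → ℂ} (hg : MemLp g 2) :
    ∑ j ∈ J, ‖coeff volume g (u j)‖ ^ 2 ≤ ∫ x, ‖g x‖ ^ 2 := by
  have h1 : ∀ w : L2 n, inner ℂ w (hg.toLp g) = coeff volume g w := fun w ↦ by
    rw [L2.inner_def, coeff]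
    refine integral_congr_ae ?_
    filter_upwards [hg.coeFn_toLp] with x hx
    rw [hx]
    exact RCLike.inner_apply _ _
  have h2 : ‖hg.toLp g‖ ^ 2 = ∫ x, ‖g x‖ ^ 2 := by
    rw [Lp.norm_toLp, hg.eLpNorm_eq_integral_rpow_norm (by simp) (by simp),
      ENNReal.toReal_ofReal (by positivity), ← Real.rpow_natCast, ← Real.rpow_mul (by positivity)]
    simp
  rw [← h2]
  simp_rw [← h1]
  exact hu.sum_inner_products_le _

end Anharmonic

theorem theorem3p1 (n k l : ℕ) (hn : 1 ≤ n) (hk : 1 ≤ k) (hl : 1 ≤ l)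
    (u : HilbertBasis ℕ ℂ (Anharmonic.L2 n)) (eigenvalue : ℕ → ℂ)
    (hu : ∀ j, Anharmonic.IsEigenfunction k l (u j) (eigenvalue j))
    (p p' : ℝ≥0∞) (hp1 : 1 ≤ p) (hp2 : p ≤ 2) (hpp' : 1 / p + 1 / p' = 1)
    (f : Anharmonic.Space n → ℂ) (hf : MemLp f p volume) :
    (∀ j, Anharmonic.supNorm (u j) < ∞) ∧
    (∀ j, Integrable (fun x ↦ f x * conj (u j x)) volume) ∧
    Anharmonic.ellNorm u p' (Anharmonic.fourierCoeff u f) ≤ eLpNorm f p volume := by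
  have hsup : ∀ j, Anharmonic.supNorm (u j) < ∞ := fun j ↦ (hu j).supNorm_lt_top hl
  have hsup0 : ∀ j, Anharmonic.supNorm (u j) ≠ 0 := fun j ↦ Anharmonic.supNorm_ne_zero (hu j).1
  have hpq : p.HolderConjugate p' := ⟨by simpa using hpp'⟩
  have hq2 : 2 ≤ p' := by
    by_contra! h
    have h1 : (2 : ℝ≥0∞)⁻¹ < p'⁻¹ := ENNReal.inv_lt_inv.2 h
    have h2 : (2 : ℝ≥0∞)⁻¹ ≤ p⁻¹ := ENNReal.inv_le_inv.2 hp2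
    have h3 := ENNReal.add_lt_add_of_le_of_lt (by simp) h2 h1
    rw [ENNReal.inv_two_add_inv_two, hpq.inv_add_inv_eq_inv, inv_one] at h3
    exact lt_irrefl _ h3
  have h2 : ∀ j, MemLp (u j) 2 volume := fun j ↦ Lp.memLp (u j)
  have htop : ∀ j, MemLp (u j) ∞ volume := fun j ↦ ⟨(h2 j).1, hsup j⟩
  have hq : ∀ j, MemLp (u j) p' volume := fun j ↦
    Anharmonic.memLp_of_two_le (h2 j) (htop j) hq2
  refine ⟨hsup, fun j ↦ Anharmonic.integrable_mul_conj hf (hq j), ?_⟩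
  rw [Anharmonic.ellNorm]
  split_ifs with hqt
  · have hpe : p = 1 := by
      have h := hpq.inv_add_inv_eq_inv
      rw [hqt] at h
      simpa using h
    subst hpe
    refine iSup_le fun j ↦ ?_
    have h := Anharmonic.enorm_coeff_le hf (hq j)
    rw [hqt] at h
    rw [← div_eq_mul_inv]
    exact ENNReal.div_le_of_le_mul h
  · have hp1' : 1 < p := by
      refine lt_of_le_of_ne hp1 fun h ↦ hqt ?_
      have h1 := hpq.inv_add_inv_eq_inv
      rw [← h, inv_one] at h1
      have h3 : (1 : ℝ≥0∞) + p'⁻¹ = 1 + 0 := by rw [h1, add_zero]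
      simpa using (ENNReal.add_right_inj ENNReal.one_ne_top).1 h3
    have hq0 : 0 < p'.toReal := ENNReal.toReal_pos (by positivity) hqt
    -- The series is the supremum of its finite partial sums, which reduces the claim to a finite
    -- set J.
    rw [one_div, ENNReal.rpow_inv_le_iff hq0, ENNReal.tsum_eq_iSup_sum]
    refine iSup_le fun J ↦ ?_
    rw [← ENNReal.rpow_inv_le_iff hq0]
    set M : ℕ → ℝ := fun j ↦ (Anharmonic.supNorm (u j)).toReal
    have hM : ∀ j, 0 < M j := fun j ↦ ENNReal.toReal_pos (hsup0 j) (hsup j).ne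
    have heM : ∀ j, ∀ᵐ x, ‖u j x‖ ≤ M j := fun j ↦ by
      have h := ae_le_eLpNormEssSup (f := (u j : Anharmonic.Space n → ℂ)) (μ := volume)
      filter_upwards [h] with x hx
      rw [← eLpNorm_exponent_top] at hx
      simpa using ENNReal.toReal_mono (hsup j).ne hx
    have key := Anharmonic.sum_rpow_coeff_le (p := p) (q := p') hp1' hp2 h2 hq hM heM (J := J)
      (fun g hg ↦ Anharmonic.sum_sq_coeff_le u.orthonormal J hg) hf
    have hsum : ∑ j ∈ J, ‖Anharmonic.fourierCoeff u f j‖ₑ ^ p'.toReal *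
        Anharmonic.supNorm (u j) ^ (2 - p'.toReal) = ENNReal.ofReal (∑ j ∈ J,
          ‖Anharmonic.coeff volume f (u j)‖ ^ p'.toReal * M j ^ (2 - p'.toReal)) := by
      rw [ENNReal.ofReal_sum_of_nonneg fun j _ ↦ mul_nonneg
        (Real.rpow_nonneg (norm_nonneg _) _) (Real.rpow_nonneg (hM j).le _)]
      refine Finset.sum_congr rfl fun j _ ↦ ?_
      rw [ENNReal.ofReal_mul (Real.rpow_nonneg (norm_nonneg _) _),
        ← ENNReal.ofReal_rpow_of_nonneg (norm_nonneg _) hq0.le,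
        ← ENNReal.ofReal_rpow_of_pos (hM j), ENNReal.ofReal_toReal (hsup j).ne, ofReal_norm]
      rfl
    rw [one_div] at key
    rw [hsum, ENNReal.ofReal_rpow_of_nonneg (Finset.sum_nonneg fun j _ ↦ mul_nonneg
        (Real.rpow_nonneg (norm_nonneg _) _) (Real.rpow_nonneg (hM j).le _)) (by positivity)]
    exact (ENNReal.ofReal_le_ofReal key).trans_eq (ENNReal.ofReal_toReal hf.eLpNorm_ne_top)
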